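/- A DEC-POMDP with players $1,\dots,n$ consists of a finite set $S$ of states with an initial state $s^{in}\in S$; for each player $i$ a finite nonempty set $\mathit{Act}_i$ of local actions and a finite set $\mathcal O_i$ of local observations; a transition function $P:S\times\mathit{Act}\to\Delta(S)$, where $\mathit{Act}=\mathit{Act}_1\times\cdots\times\mathit{Act}_n$; and an observation function $O:S\times\mathit{Act}\times S\to\Delta(\mathcal O)$, where $\mathcal O=\mathcal O_1\times\cdots\times\mathcal O_n$. Here $\Delta(X)$ denotes the set of probability distributions on $X$. A play is an infinite sequence $s_0\vec a_0\vec o_0s_1\vec a_1\vec o_1\cdots$ with $s_0=s^{in}$. A strategy of player $i$ is a function $\sigma_i:\mathcal O_i^*\to\Delta(\mathit{Act}_i)$ that maps the sequence of local observations received so far to a distribution over local actions. Under a strategy profile $\vec\sigma=(\sigma_1,\dots,\sigma_n)$, in each step the players choose their local actions independently according to their strategies, giving $\vec a_k$; then $s_{k+1}$ is chosen according to $P(s_k,\vec a_k)$, and then $\vec o_k$ according to $O(s_k,\vec a_k,s_{k+1})$. Let $\mathrm{Pr}^{\vec\sigma}$ be the induced probability measure on plays and, for $T\subseteq S$, let $\diamond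 T$ be the set of plays that visit $T$. Theorem. For every $n\ge 2$ the following problem is undecidable. Input: a DEC-POMDP with $n$ players in which all probabilities are rational (given by finite tables), and a set $T$ of states. Question: does there exist a strategy profile $\vec\sigma$ with $\mathrm{Pr}^{\vec\sigma}(\diamond T)=1$? That is, no algorithm answers this question correctly on all such inputs. -/

import Mathlib

open MeasureTheory ProbabilityTheory
open scoped ENNReal

/-- A decentralised partially observable Markov decision process with players `Fin n`, state set `S`,
local action sets `A i` and local observation sets `O i` (the sets are assumed finite wherever plays
are considered). Being indexed by the player, the local action sets are automatically disjoint. -/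
structure DecPOMDP (n : ℕ) (S : Type) (A O : Fin n → Type) where
  /-- the initial state -/
  init : S
  /-- the transition function `P : S × Act → Δ(S)` -/
  trans : S → (∀ i, A i) → PMF S
  /-- the observation function `O : S × Act × S → Δ(O)` -/
  obs : S → (∀ i, A i) → S → PMF (∀ i, O i)

namespace DecPOMDP

/-- A (randomised) strategy profile: player `i` chooses the distribution of the next local action from
the sequence (oldest first) of the local observations received so far, and from nothing else. -/
def StrategyProfile {n : ℕ} (A O : Fin n → Type) : Type :=
  ∀ i, List (O i) → PMF (A i)

/-- The product distribution: the coordinates are chosen independently. -/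
noncomputable def indep {n : ℕ} {A : Fin n → Type} [∀ i, Fintype (A i)]
    (p : ∀ i, PMF (A i)) : PMF (∀ i, A i) :=
  PMF.ofFintype (fun a => ∏ i, p i (a i)) (by
    classical
    rw [← Fintype.piFinset_univ, ← Finset.prod_univ_sum]
    refine Finset.prod_eq_one fun i _ => ?_
    rw [← tsum_fintype (L := .unconditional _)]
    exact (p i).tsum_coe)

/-- A play `s₀ a₀ o₀ s₁ a₁ o₁ …` is stored as the sequence of items
`⟨s₀, none⟩, ⟨s₁, some (a₀, o₀)⟩, ⟨s₂, some (a₁, o₁)⟩, …`: each state comes together with the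
global action and the global observation of the step that led to it. -/
@[ext]
structure Item {n : ℕ} (S : Type) (A O : Fin n → Type) where
  state : S
  last : Option ((∀ i, A i) × (∀ i, O i))

instance {n : ℕ} {S : Type} {A O : Fin n → Type} : MeasurableSpace (Item S A O) := ⊤

instance {n : ℕ} {S : Type} {A O : Fin n → Type} : DiscreteMeasurableSpace (Item S A O) :=
  ⟨fun _ => trivial⟩

instance {n : ℕ} {S : Type} {A O : Fin n → Type} [Finite S] [∀ i, Finite (A i)]
    [∀ i, Finite (O i)] : Finite (Item S A O) :=
  Finite.of_injective (fun x : Item S A O => (x.state, x.last)) fun _ _ h =>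
    Item.ext (congrArg Prod.fst h) (congrArg Prod.snd h)

/-- The sequence of observations that player `i` received during the first `k` steps of a play. -/
def localHistory {n : ℕ} {S : Type} {A O : Fin n → Type} {k : ℕ}
    (h : Finset.Iic k → Item S A O) (i : Fin n) : List (O i) :=
  (List.finRange (k + 1)).filterMap fun j : Fin (k + 1) =>
    (h ⟨(j : ℕ), Finset.mem_Iic.2 (Nat.lt_succ_iff.1 j.isLt)⟩).last.map fun ao => ao.2 i

variable {n : ℕ} {S : Type} {A O : Fin n → Type} [Fintype S] [∀ i, Fintype (A i)]
  [∀ i, Fintype (O i)]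

/-- One step of the process after the history `h`: the players choose their actions independently,
each from its own observations; then the next state is drawn, then the observations. -/
noncomputable def step (M : DecPOMDP n S A O) (σ : StrategyProfile A O) {k : ℕ}
    (h : Finset.Iic k → Item S A O) : PMF (Item S A O) :=
  let s : S := (h ⟨k, Finset.mem_Iic.2 le_rfl⟩).state
  (indep fun i => σ i (localHistory h i)).bind fun a =>
    (M.trans s a).bind fun s' =>
      (M.obs s a s').bind fun o => PMF.pure ⟨s', some (a, o)⟩

noncomputable def stepKernel (M : DecPOMDP n S A O) (σ : StrategyProfile A O) (k : ℕ) :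
    Kernel (Finset.Iic k → Item S A O) (Item S A O) :=
  Kernel.ofFunOfCountable fun h => (M.step σ h).toMeasure

instance (M : DecPOMDP n S A O) (σ : StrategyProfile A O) (k : ℕ) :
    IsMarkovKernel (M.stepKernel σ k) :=
  ⟨fun h => inferInstanceAs (IsProbabilityMeasure (M.step σ h).toMeasure)⟩

/-- The probability measure on infinite plays induced by a strategy profile: the play starts in the
initial state and every further item is drawn according to `step` (Ionescu-Tulcea extension). -/
noncomputable def playMeasure (M : DecPOMDP n S A O) (σ : StrategyProfile A O) :
    Measure (ℕ → Item S A O) :=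
  Kernel.traj (M.stepKernel σ) 0 fun _ => ⟨M.init, none⟩

/-- The plays that visit the target set `T`. -/
def reach {n : ℕ} {S : Type} (A O : Fin n → Type) (T : Set S) : Set (ℕ → Item S A O) :=
  {ρ | ∃ k, (ρ k).state ∈ T}

end DecPOMDP

/-- The distribution on a finite set with rational probabilities `w a / ∑ b, w b`. -/
noncomputable def weightPMF {α : Type} [Fintype α] (w : α → ℕ) (hw : 0 < ∑ a, w a) : PMF α :=
  PMF.ofFintype (fun a => (w a : ℝ≥0∞) / ((∑ b, w b : ℕ) : ℝ≥0∞)) (by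
    simp only [div_eq_mul_inv]
    rw [← Finset.sum_mul, ← Nat.cast_sum]
    exact ENNReal.mul_inv_cancel (by exact_mod_cast hw.ne') (ENNReal.natCast_ne_top _))

/-- The finite description of an input of the decision problem: a DEC-POMDP with `n` players and
rational probabilities, together with a target set. States, local actions and local observations
are numbered from `0`. The probabilities are given by lists of weighted entries: the weight of a key
is the sum of the numbers that the list attaches to it, and probabilities are proportional to the
weights (so exactly the distributions with rational probabilities can be described). -/
structure DecPOMDPCode (n : ℕ) where
  numStates : ℕ
  numActs : Fin n → ℕ
  numObs : Fin n → ℕ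
  init : ℕ
  /-- entries `((s, a, s'), w)` -/
  trans : List ((ℕ × (Fin n → ℕ) × ℕ) × ℕ)
  /-- entries `((s, a, s', o), w)` -/
  obs : List ((ℕ × (Fin n → ℕ) × ℕ × (Fin n → ℕ)) × ℕ)
  target : List ℕ

namespace DecPOMDPCode

/-- Codes as tuples of natural numbers and lists. -/
def equivTuple (n : ℕ) : DecPOMDPCode n ≃
    ℕ × (Fin n → ℕ) × (Fin n → ℕ) × ℕ × List ((ℕ × (Fin n → ℕ) × ℕ) × ℕ) ×
      List ((ℕ × (Fin n → ℕ) × ℕ × (Fin n → ℕ)) × ℕ) × List ℕ where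
  toFun c := (c.numStates, c.numActs, c.numObs, c.init, c.trans, c.obs, c.target)
  invFun t := ⟨t.1, t.2.1, t.2.2.1, t.2.2.2.1, t.2.2.2.2.1, t.2.2.2.2.2.1, t.2.2.2.2.2.2⟩
  left_inv _ := rfl
  right_inv _ := rfl

instance (n : ℕ) : Primcodable (DecPOMDPCode n) := Primcodable.ofEquiv _ (equivTuple n)

/-- The weight that a list of weighted entries gives to a key. -/
def weight {K : Type} [DecidableEq K] (l : List (K × ℕ)) (key : K) : ℕ :=
  ((l.filter fun e => e.1 = key).map Prod.snd).sum

variable {n : ℕ}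

abbrev State (c : DecPOMDPCode n) : Type := Fin c.numStates

abbrev Act (c : DecPOMDPCode n) (i : Fin n) : Type := Fin (c.numActs i)

abbrev Obs (c : DecPOMDPCode n) (i : Fin n) : Type := Fin (c.numObs i)

def transWeight (c : DecPOMDPCode n) (s : c.State) (a : ∀ i, c.Act i) (s' : c.State) : ℕ :=
  weight c.trans ((s : ℕ), (fun i => (a i : ℕ)), (s' : ℕ))

def obsWeight (c : DecPOMDPCode n) (s : c.State) (a : ∀ i, c.Act i) (s' : c.State)
    (o : ∀ i, c.Obs i) : ℕ :=
  weight c.obs ((s : ℕ), (fun i => (a i : ℕ)), (s' : ℕ), (fun i => (o i : ℕ)))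

/-- The codes that describe a DEC-POMDP: the initial state exists, every player has an action, and
every required distribution has positive total weight. -/
structure Valid (c : DecPOMDPCode n) : Prop where
  init_lt : c.init < c.numStates
  acts_pos : ∀ i, 0 < c.numActs i
  trans_pos : ∀ (s : c.State) (a : ∀ i, c.Act i), 0 < ∑ s', c.transWeight s a s'
  obs_pos : ∀ (s : c.State) (a : ∀ i, c.Act i) (s' : c.State), 0 < ∑ o, c.obsWeight s a s' o

/-- The DEC-POMDP described by a valid code. -/
noncomputable def toDecPOMDP (c : DecPOMDPCode n) (hc : c.Valid) :
    DecPOMDP n c.State c.Act c.Obs where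
  init := ⟨c.init, hc.init_lt⟩
  trans s a := weightPMF (c.transWeight s a) (hc.trans_pos s a)
  obs s a s' := weightPMF (c.obsWeight s a s') (hc.obs_pos s a s')

/-- The target set described by a code. -/
def targetSet (c : DecPOMDPCode n) : Set c.State := {s | (s : ℕ) ∈ c.target}

end DecPOMDPCode

/-!
Reachability with probability one is undecidable already for two players, because two players who
cannot communicate can be cross-examined about a computation. The proof reduces the non-halting of a
fixed Turing machine on a unary input `j` to the existence of an almost surely winning profile.

The reduction is a game (`TapeGame.succ`). Each player is sent signals that name a time and a
position relative to the head, and its action is read as the symbol that the tape of the machine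
carries there and then; the game itself keeps track only of the machine state. At random moments it
branches off into one of three checks. The answers about the initial tape are verified directly
along a chain of `j` states. The answers of both players about the same time are compared
cell by cell, which forces them to be equal. In a delayed comparison the first player is asked about
time `t` and the second about time `t + 1`; the second cannot tell this from the first kind of
comparison one step later, and the shift between the two positions is absorbed by a queue of at most
two symbols, so that the check needs only finitely many states. Hence players who are never caught
describe an infinite run (`TapeGame.exists_isRun`), and an infinite run, described truthfully,
never fails a check (`TapeGame.exists_passing`). The machine halts in no such run since halting is
rejected. Additional players are ignored.

Rejection and acceptance are absorbing, and until then every step decreases a rank with positive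
probability, so the game ends almost surely (`DecPOMDP.ae_exists_state_mem`). A profile therefore
wins almost surely if and only if no rejecting play has positive probability, and in that case any
deterministic choice of actions from its support wins as well. So randomisation is of no use, and the exact
probabilities play no role (`DecPOMDP.exists_playMeasure_reach_eq_one_iff`).

The machine is obtained from Mathlib's compilation of partial recursive functions into stack
machines and further into machines with one tape (`TapeRun.exists_undecidable_machine`). The number
of states of the game depends on the input only through the chain, and its tables are primitive
recursive in the input (`TapeGame.Numbering.computable_code`).
-/

/-! ### Almost-sure reachability in a decentralised process -/

namespace DecPOMDP

section Expectation

variable {α β : Type*}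

theorem tsum_bind_mul (p : PMF α) (q : α → PMF β) (g : β → ℝ≥0∞) :
    ∑' b, p.bind q b * g b = ∑' a, p a * ∑' b, q a b * g b := by
  simp_rw [PMF.bind_apply, ← ENNReal.tsum_mul_right, ← ENNReal.tsum_mul_left, mul_assoc]
  exact ENNReal.tsum_comm

theorem tsum_pure_mul (a : α) (g : α → ℝ≥0∞) : ∑' b, PMF.pure a b * g b = g a := by
  rw [tsum_eq_single a fun b hb => by simp [hb]]
  simp

theorem tsum_mul_const (p : PMF α) (c : ℝ≥0∞) : ∑' a, p a * c = c := by
  rw [ENNReal.tsum_mul_right, p.tsum_coe, one_mul]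

end Expectation

variable {n : ℕ} {S : Type} {A O : Fin n → Type}

theorem indep_apply [∀ i, Fintype (A i)] (p : ∀ i, PMF (A i)) (a : ∀ i, A i) :
    indep p a = ∏ i, p i (a i) := rfl

theorem localHistory_zero (x : Item S A O) (hx : x.last = none) (i : Fin n) :
    localHistory (k := 0) (fun _ => x) i = [] := by
  simp [localHistory, hx]

theorem localHistory_succ (ρ : ℕ → Item S A O) (k : ℕ) (i : Fin n) :
    localHistory (Preorder.frestrictLe (k + 1) ρ) i =
      localHistory (Preorder.frestrictLe k ρ) i ++
        ((ρ (k + 1)).last.map fun ao => ao.2 i).toList := by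
  simp only [localHistory, Preorder.frestrictLe_apply]
  rw [List.finRange_succ_last, List.filterMap_append, List.filterMap_map]
  simp only [List.filterMap_cons, List.filterMap_nil, Fin.val_last]
  cases (ρ (k + 1)).last <;> rfl

theorem step_ne_zero_iff [∀ i, Fintype (A i)] (M : DecPOMDP n S A O) (σ : StrategyProfile A O)
    {k : ℕ} (h : Finset.Iic k → Item S A O) (x : Item S A O) :
    M.step σ h x ≠ 0 ↔ ∃ a o, x.last = some (a, o) ∧ (∀ i, σ i (localHistory h i) (a i) ≠ 0) ∧
      M.trans (h ⟨k, Finset.mem_Iic.2 le_rfl⟩).state a x.state ≠ 0 ∧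
      M.obs (h ⟨k, Finset.mem_Iic.2 le_rfl⟩).state a x.state o ≠ 0 := by
  simp only [step, ← PMF.mem_support_iff, PMF.mem_support_bind_iff, PMF.mem_support_pure_iff]
  simp only [PMF.mem_support_iff, indep_apply, Finset.prod_ne_zero_iff, Finset.mem_univ,
    true_imp_iff]
  constructor
  · rintro ⟨a, ha, s', hs', o, ho, rfl⟩
    exact ⟨a, o, rfl, ha, hs', ho⟩
  · rintro ⟨a, o, hl, ha, hs', ho⟩
    exact ⟨a, ha, x.state, hs', o, ho, Item.ext rfl hl⟩

variable [Fintype S] [∀ i, Fintype (A i)] [∀ i, Fintype (O i)]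
variable (M : DecPOMDP n S A O) (σ : StrategyProfile A O)

instance : IsProbabilityMeasure (M.playMeasure σ) := by
  unfold playMeasure
  infer_instance

theorem ae_frestrictLe_zero :
    ∀ᵐ ρ ∂M.playMeasure σ, Preorder.frestrictLe 0 ρ = fun _ => (⟨M.init, none⟩ : Item S A O) := by
  have h := Kernel.traj_map_frestrictLe_apply (X := fun _ => Item S A O) (κ := M.stepKernel σ) 0 0
    fun _ => ⟨M.init, none⟩
  rw [Kernel.partialTraj_self, Kernel.id_apply] at h
  refine ae_of_ae_map (f := Preorder.frestrictLe (π := fun _ => Item S A O) 0)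
    (p := fun x => x = fun _ => (⟨M.init, none⟩ : Item S A O)) (by fun_prop) ?_
  rw [playMeasure, h]
  exact (ae_dirac_iff (measurableSet_eq)).2 rfl

/-- The law of the next item given the history, in integrated form. -/
theorem lintegral_step (k : ℕ) (g : (Finset.Iic k → Item S A O) → Item S A O → ℝ≥0∞) :
    ∫⁻ ρ, g (Preorder.frestrictLe k ρ) (ρ (k + 1)) ∂M.playMeasure σ =
      ∫⁻ ρ, ∑' x, M.step σ (Preorder.frestrictLe k ρ) x * g (Preorder.frestrictLe k ρ) x
        ∂M.playMeasure σ := by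
  have hg : Measurable (Function.uncurry g) := .of_discrete
  have h := Kernel.partialTraj_compProd_eq_map_traj (X := fun _ => Item S A O)
    (κ := M.stepKernel σ) (zero_le (a := k)) (x₀ := fun _ => ⟨M.init, none⟩)
  have h1 : ∫⁻ ρ, g (Preorder.frestrictLe k ρ) (ρ (k + 1)) ∂M.playMeasure σ =
      ∫⁻ y, Function.uncurry g y ∂((M.playMeasure σ).map
        fun ρ => (Preorder.frestrictLe k ρ, ρ (k + 1))) := by
    rw [lintegral_map hg (by fun_prop)]
    rfl
  rw [h1, playMeasure, ← h, Measure.lintegral_compProd hg, ← Kernel.traj_map_frestrictLe_apply,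
    lintegral_map .of_discrete (by fun_prop)]
  refine lintegral_congr fun ρ => ?_
  rw [lintegral_countable']
  refine tsum_congr fun x => ?_
  rw [mul_comm]
  congr 1
  exact PMF.toMeasure_apply_singleton _ _ (measurableSet_singleton x)

/-- A property of the next item that is certain given the history holds almost surely. -/
theorem ae_step {k : ℕ} {P : (Finset.Iic k → Item S A O) → Prop}
    {Q : (Finset.Iic k → Item S A O) → Item S A O → Prop}
    (hP : ∀ᵐ ρ ∂M.playMeasure σ, P (Preorder.frestrictLe k ρ))
    (hQ : ∀ h x, P h → M.step σ h x ≠ 0 → Q h x) :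
    ∀ᵐ ρ ∂M.playMeasure σ, Q (Preorder.frestrictLe k ρ) (ρ (k + 1)) := by
  classical
  have h := lintegral_step M σ k fun h x => if Q h x then 0 else 1
  have h0 : ∀ᵐ ρ ∂M.playMeasure σ, ∑' x, M.step σ (Preorder.frestrictLe k ρ) x *
      (if Q (Preorder.frestrictLe k ρ) x then 0 else 1 : ℝ≥0∞) = 0 := by
    filter_upwards [hP] with ρ hρ
    rw [ENNReal.tsum_eq_zero]
    intro x
    split_ifs with hx
    · simp
    · rw [mul_one]
      by_contra h
      exact hx (hQ _ _ hρ h)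
  rw [lintegral_congr_ae h0, lintegral_zero, lintegral_eq_zero_iff] at h
  · filter_upwards [h] with ρ hρ
    by_contra hn
    simp [hn] at hρ
  · exact (Measurable.of_discrete (f := fun p : (Finset.Iic k → Item S A O) × Item S A O =>
      if Q p.1 p.2 then (0 : ℝ≥0∞) else 1)).comp
        (show Measurable fun ρ : ℕ → Item S A O => (Preorder.frestrictLe k ρ, ρ (k + 1))
          by fun_prop)

/-- An event of positive probability that depends on the history can be continued by any item of
positive probability. -/
theorem frequently_step {k : ℕ} {P : (Finset.Iic k → Item S A O) → Prop}
    {Q : (Finset.Iic k → Item S A O) → Item S A O → Prop}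
    (hP : ∃ᵐ ρ ∂M.playMeasure σ, P (Preorder.frestrictLe k ρ))
    (hQ : ∀ h, P h → ∃ x, M.step σ h x ≠ 0 ∧ Q h x) :
    ∃ᵐ ρ ∂M.playMeasure σ, Q (Preorder.frestrictLe k ρ) (ρ (k + 1)) := by
  classical
  intro hn
  have h := lintegral_step M σ k fun h x => if Q h x then 1 else 0
  have h0 : ∀ᵐ ρ ∂M.playMeasure σ,
      (if Q (Preorder.frestrictLe k ρ) (ρ (k + 1)) then 1 else 0 : ℝ≥0∞) = 0 := by
    filter_upwards [hn] with ρ hρ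
    simp [hρ]
  rw [lintegral_congr_ae h0, lintegral_zero, eq_comm, lintegral_eq_zero_iff] at h
  · refine hP ?_
    filter_upwards [h] with ρ hρ hp
    obtain ⟨x, hx, hq⟩ := hQ _ hp
    have := ENNReal.tsum_eq_zero.1 hρ x
    simp [hq, hx] at this
  · exact (Measurable.of_discrete (f := fun h : Finset.Iic k → Item S A O =>
      ∑' x, M.step σ h x * (if Q h x then (1 : ℝ≥0∞) else 0))).comp (by fun_prop)

/-- The profile in which player `i` plays the action `F i w` after the observations `w`. -/
noncomputable def pureProfile (F : ∀ i, List (O i) → A i) : StrategyProfile A O :=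
  fun i w => PMF.pure (F i w)

/-- The pairs of a state and local histories that occur in some play in which the players follow
the deterministic strategies `F`. -/
inductive Reachable (F : ∀ i, List (O i) → A i) : S → (∀ i, List (O i)) → Prop
  | init : Reachable F M.init fun _ => []
  | step {s H s' o} : Reachable F s H → M.trans s (fun i => F i (H i)) s' ≠ 0 →
      M.obs s (fun i => F i (H i)) s' o ≠ 0 → Reachable F s' fun i => H i ++ [o i]

variable {M σ}

/-- Under a profile that gives positive probability to the actions of `F`, everything reachable
with `F` occurs with positive probability. -/
theorem Reachable.frequently {F : ∀ i, List (O i) → A i} (hF : ∀ i w, σ i w (F i w) ≠ 0)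
    {s : S} {H : ∀ i, List (O i)} (h : M.Reachable F s H) :
    ∃ k, ∃ᵐ ρ ∂M.playMeasure σ, (ρ k).state = s ∧
      ∀ i, localHistory (Preorder.frestrictLe k ρ) i = H i := by
  induction h with
  | init =>
    refine ⟨0, Filter.Eventually.frequently ?_⟩
    filter_upwards [ae_frestrictLe_zero M σ] with ρ hρ
    refine ⟨congrArg Item.state (congrFun hρ ⟨0, by simp⟩), fun i => ?_⟩
    rw [hρ]
    exact localHistory_zero _ rfl i
  | @step s H s' o _ ht ho ih =>
    obtain ⟨k, hk⟩ := ih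
    refine ⟨k + 1, ?_⟩
    have := frequently_step M σ (k := k)
      (P := fun h => (h ⟨k, Finset.mem_Iic.2 le_rfl⟩).state = s ∧ ∀ i, localHistory h i = H i)
      (Q := fun h x => (∀ i, localHistory h i = H i) ∧ x.state = s' ∧
        ∃ a, x.last = some (a, o)) hk ?_
    · refine this.mono fun ρ hρ => ⟨hρ.2.1, fun i => ?_⟩
      obtain ⟨h1, _, a, h2⟩ := hρ
      rw [localHistory_succ, h1, h2]
      rfl
    · rintro h ⟨rfl, h2⟩
      refine ⟨⟨s', some (fun i => F i (H i), o)⟩, ?_, h2, rfl, _, rfl⟩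
      rw [step_ne_zero_iff]
      exact ⟨_, _, rfl, fun i => by rw [h2]; exact hF i _, ht, ho⟩

theorem ae_reachable (F : ∀ i, List (O i) → A i) (k : ℕ) :
    ∀ᵐ ρ ∂M.playMeasure (pureProfile F),
      M.Reachable F (ρ k).state (localHistory (Preorder.frestrictLe k ρ)) := by
  induction k with
  | zero =>
    filter_upwards [ae_frestrictLe_zero M (pureProfile F)] with ρ hρ
    have h1 : (ρ 0).state = M.init := congrArg Item.state (congrFun hρ ⟨0, by simp⟩)
    have h2 : localHistory (Preorder.frestrictLe 0 ρ) = fun _ => [] := by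
      rw [hρ]
      exact funext fun i => localHistory_zero _ rfl i
    rw [h1, h2]
    exact .init
  | succ k ih =>
    have := ae_step M (pureProfile F) (k := k)
      (P := fun h => M.Reachable F (h ⟨k, Finset.mem_Iic.2 le_rfl⟩).state (localHistory h))
      (Q := fun h x => M.Reachable F x.state fun i =>
        localHistory h i ++ (x.last.map fun ao => ao.2 i).toList) ih ?_
    · filter_upwards [this] with ρ hρ
      rw [funext (localHistory_succ ρ k)]
      exact hρ
    · intro h x hr hx
      obtain ⟨a, o, hl, ha, ht, ho⟩ := (step_ne_zero_iff _ _ _ _).1 hx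
      have : a = fun i => F i (localHistory h i) := by
        ext i
        exact (PMF.mem_support_pure_iff _ _).1 ((PMF.mem_support_iff _ _).2 (ha i))
      subst this
      rw [hl]
      exact hr.step ht ho

variable (M σ)

theorem ae_state_mem_of_closed {R : Set S}
    (hR : ∀ s ∈ R, ∀ a s', M.trans s a s' ≠ 0 → s' ∈ R) :
    ∀ᵐ ρ ∂M.playMeasure σ, ∀ j k, j ≤ k → (ρ j).state ∈ R → (ρ k).state ∈ R := by
  have : ∀ k, ∀ᵐ ρ ∂M.playMeasure σ, (ρ k).state ∈ R → (ρ (k + 1)).state ∈ R := by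
    intro k
    refine ae_step M σ (k := k) (P := fun _ => True)
      (Q := fun h x => (h ⟨k, Finset.mem_Iic.2 le_rfl⟩).state ∈ R → x.state ∈ R) (by simp) ?_
    intro h x _ hx hs
    obtain ⟨a, o, -, -, ht, -⟩ := (step_ne_zero_iff _ _ _ _).1 hx
    exact hR _ hs a _ ht
  filter_upwards [ae_all_iff.2 this] with ρ hρ j k hjk hj
  induction k, hjk using Nat.le_induction with
  | base => exact hj
  | succ k _ ih => exact hρ k ih

/-- If every transition contracts the expectation of `W` by the factor `r`, so does a step of the
play, whatever the players do. -/
theorem lintegral_state_succ_le (W : S → ℝ≥0∞) (r : ℝ≥0∞)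
    (hW : ∀ s a, ∑' s', M.trans s a s' * W s' ≤ r * W s) (k : ℕ) :
    ∫⁻ ρ, W (ρ (k + 1)).state ∂M.playMeasure σ ≤ r * ∫⁻ ρ, W (ρ k).state ∂M.playMeasure σ := by
  rw [lintegral_step M σ k fun _ x => W x.state, ← lintegral_const_mul]
  · refine lintegral_mono fun ρ => ?_
    simp only [step, tsum_bind_mul, tsum_pure_mul, tsum_mul_const]
    refine (ENNReal.tsum_le_tsum fun a => mul_le_mul_right (hW _ a) _).trans ?_
    rw [tsum_mul_const]
    rfl
  · exact (Measurable.of_discrete (f := fun x : Item S A O => W x.state)).comp (by fun_prop)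

/-- If from every state outside `D` a rank never increases and decreases with positive
probability, unless `D` is entered, then `D` is reached almost surely, whatever the players do: the
expectation of `2 ^ rank`, put to zero on `D`, decays geometrically. -/
theorem ae_exists_state_mem (D : Set S) (rank : S → ℕ)
    (hD : ∀ s ∈ D, ∀ a s', M.trans s a s' ≠ 0 → s' ∈ D)
    (hle : ∀ s ∉ D, ∀ a s', M.trans s a s' ≠ 0 → s' ∈ D ∨ rank s' ≤ rank s)
    (hlt : ∀ s ∉ D, ∀ a, ∃ s', M.trans s a s' ≠ 0 ∧ (s' ∈ D ∨ rank s' < rank s)) :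
    ∀ᵐ ρ ∂M.playMeasure σ, ∃ k, (ρ k).state ∈ D := by
  classical
  let W : S → ℝ≥0∞ := fun s => if s ∈ D then 0 else 2 ^ rank s
  have hWtop : ∀ s, W s ≠ ∞ := fun s => by
    simp only [W]
    split_ifs <;> simp
  -- `δ` bounds the positive transition probabilities from below. In each step `W` is at least
  -- halved with probability at least `δ`, so its expectation shrinks by the factor `1 - δ / 2`.
  obtain ⟨δ, hδ0, hδ⟩ : ∃ δ : ℝ≥0∞, δ ≠ 0 ∧ ∀ s a s', M.trans s a s' ≠ 0 → δ ≤ M.trans s a s' := by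
    refine ⟨Finset.univ.inf fun x : S × (∀ i, A i) × S =>
      if M.trans x.1 x.2.1 x.2.2 = 0 then 1 else M.trans x.1 x.2.1 x.2.2, ?_, ?_⟩
    · refine pos_iff_ne_zero.1 ((Finset.lt_inf_iff ENNReal.zero_lt_top).2 fun x _ => ?_)
      split_ifs with h
      · simp
      · exact pos_iff_ne_zero.2 h
    · intro s a s' h
      refine (Finset.inf_le (Finset.mem_univ (s, a, s'))).trans ?_
      simp [h]
  have hW : ∀ s a, ∑' s', M.trans s a s' * W s' ≤ (1 - δ / 2) * W s := by
    intro s a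
    by_cases hs : s ∈ D
    · refine le_of_eq_of_le (ENNReal.tsum_eq_zero.2 fun s' => ?_) zero_le
      by_cases h : M.trans s a s' = 0
      · simp [h]
      · simp [W, hD s hs a s' h]
    · obtain ⟨s₀, h0, h1⟩ := hlt s hs a
      rw [ENNReal.sub_mul fun _ _ => hWtop s, one_mul]
      refine ENNReal.le_sub_of_add_le_right
        (ENNReal.mul_ne_top (ENNReal.div_ne_top ((hδ _ _ _ h0).trans_lt
          (PMF.apply_lt_top _ _)).ne (by simp)) (hWtop s)) ?_
      have h2 : δ / 2 * W s ≤ ∑' s', M.trans s a s' * (if s' = s₀ then W s / 2 else 0) := by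
        rw [tsum_eq_single s₀ fun s' h => by simp [h], if_pos rfl, ENNReal.div_eq_inv_mul,
          ENNReal.div_eq_inv_mul, mul_right_comm, mul_comm _ δ]
        exact mul_le_mul_left (hδ _ _ _ h0) _
      refine (add_le_add_right h2 _).trans ?_
      rw [← ENNReal.tsum_add]
      refine le_of_le_of_eq ?_ (tsum_mul_const (M.trans s a) (W s))
      refine ENNReal.tsum_le_tsum fun s' => ?_
      rw [← mul_add]
      by_cases h : M.trans s a s' = 0
      · simp [h]
      refine mul_le_mul_right ?_ _
      split_ifs with he
      · subst he
        rcases h1 with h1 | h1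
        · simp only [W, h1, if_true, zero_add]
          exact ENNReal.half_le_self
        · have : W s' ≤ W s / 2 := by
            rw [ENNReal.le_div_iff_mul_le (by simp) (by simp)]
            simp only [W, hs, if_false]
            split_ifs
            · simp
            · rw [← pow_succ]
              exact pow_le_pow_right₀ (by norm_num) h1
          exact (add_le_add_left this _).trans_eq (ENNReal.add_halves _)
      · rw [add_zero]
        simp only [W, hs, if_false]
        rcases hle s hs a s' h with h3 | h3
        · simp [h3]
        · split_ifs
          · simp
          · exact pow_le_pow_right₀ (by norm_num) h3
  have hk : ∀ k, ∫⁻ ρ, W (ρ k).state ∂M.playMeasure σ ≤ (1 - δ / 2) ^ k * W M.init := by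
    intro k
    induction k with
    | zero =>
      have : ∀ᵐ ρ ∂M.playMeasure σ, W (ρ 0).state = W M.init := by
        filter_upwards [ae_frestrictLe_zero M σ] with ρ hρ
        exact congrArg (fun x => W (Item.state x)) (congrFun hρ ⟨0, by simp⟩)
      rw [lintegral_congr_ae this]
      simp
    | succ k ih =>
      refine (lintegral_state_succ_le M σ W _ hW k).trans ?_
      rw [pow_succ', mul_assoc]
      exact mul_le_mul_right ih _
  have hbound : ∀ k, M.playMeasure σ {ρ | ¬ ∃ k, (ρ k).state ∈ D} ≤ (1 - δ / 2) ^ k * W M.init := by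
    intro k
    refine le_trans ?_ (hk k)
    refine (measure_mono (t := {ρ | 1 ≤ W (ρ k).state}) fun ρ hρ => ?_).trans ?_
    · have : (ρ k).state ∉ D := fun h => hρ ⟨k, h⟩
      simp only [W, Set.mem_ofPred_eq, this, if_false]
      exact one_le_pow₀ (by norm_num)
    · have := mul_meas_ge_le_lintegral (μ := M.playMeasure σ) (f := fun ρ => W (ρ k).state)
        ((Measurable.of_discrete (f := fun x : Item S A O => W x.state)).comp
          (measurable_pi_apply k)) 1
      rwa [one_mul] at this
  rw [ae_iff]
  refine le_antisymm (ge_of_tendsto' (x := Filter.atTop) ?_ hbound) zero_le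
  have h1 : (1 - δ / 2 : ℝ≥0∞) < 1 :=
    ENNReal.sub_lt_self (by simp) (by simp) (by simp [hδ0])
  have := ENNReal.Tendsto.mul_const (ENNReal.tendsto_pow_atTop_nhds_zero_of_lt_one h1)
    (Or.inr (hWtop M.init))
  simpa using this

/-- Let `T` and `R` be disjoint absorbing sets, one of which is reached for certain by the ranking
condition. Then `T` can be reached almost surely if and only if there are deterministic strategies
under which no play enters `R`. -/
theorem exists_playMeasure_reach_eq_one_iff (T R : Set S) (rank : S → ℕ)
    (hTR : ∀ s ∈ T, s ∉ R)
    (hT : ∀ s ∈ T, ∀ a s', M.trans s a s' ≠ 0 → s' ∈ T)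
    (hR : ∀ s ∈ R, ∀ a s', M.trans s a s' ≠ 0 → s' ∈ R)
    (hle : ∀ s a s', M.trans s a s' ≠ 0 → rank s' ≤ rank s)
    (hlt : ∀ s, s ∉ T → s ∉ R → ∀ a, ∃ s', M.trans s a s' ≠ 0 ∧ rank s' < rank s) :
    (∃ σ, M.playMeasure σ (reach A O T) = 1) ↔
      ∃ F, ∀ s H, M.Reachable F s H → s ∉ R := by
  have hmeas : MeasurableSet (reach A O T : Set (ℕ → Item S A O)) := by
    have : (reach A O T : Set (ℕ → Item S A O)) = ⋃ k, {ρ | (ρ k).state ∈ T} := by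
      ext
      simp [reach]
    rw [this]
    refine .iUnion fun k => ?_
    change MeasurableSet ((fun ρ : ℕ → Item S A O => ρ k) ⁻¹' {x | x.state ∈ T})
    exact measurable_pi_apply k .of_discrete
  constructor
  · rintro ⟨σ, hσ⟩
    choose F hF using fun i w => (σ i w).support_nonempty
    refine ⟨F, fun s H h hs => ?_⟩
    obtain ⟨k, hk⟩ := h.frequently fun i w => (PMF.mem_support_iff _ _).1 (hF i w)
    refine hk ?_
    filter_upwards [(mem_ae_iff_prob_eq_one hmeas).2 hσ, ae_state_mem_of_closed M σ hT,
      ae_state_mem_of_closed M σ hR] with ρ h1 h2 h3 h4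
    obtain ⟨j, hj⟩ := h1
    exact hTR _ (h2 j (max j k) (le_max_left _ _) hj)
      (h3 k (max j k) (le_max_right _ _) (h4.1 ▸ hs))
  · rintro ⟨F, hF⟩
    refine ⟨pureProfile F, (mem_ae_iff_prob_eq_one hmeas).1 ?_⟩
    filter_upwards [ae_all_iff.2 (ae_reachable (M := M) F),
      ae_exists_state_mem M (pureProfile F) (T ∪ R) rank
        (by
          rintro s (hs | hs) a s' h
          · exact .inl (hT s hs a s' h)
          · exact .inr (hR s hs a s' h))
        (fun s _ a s' h => .inr (hle s a s' h))
        (fun s hs a => (hlt s (fun h => hs (.inl h)) (fun h => hs (.inr h)) a).imp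
          fun s' h => ⟨h.1, .inr h.2⟩)] with ρ h1 h2
    obtain ⟨k, hk⟩ := h2
    exact ⟨k, hk.resolve_right (hF _ _ (h1 k))⟩

end DecPOMDP

/-! ### A Turing machine with an undecidable halting problem -/

namespace TapeRun

open Turing

/-- The effect of a machine instruction on a tape whose cells are numbered relative to the head. -/
def apply {Γ : Type*} : TM0.Stmt Γ → (ℤ → Γ) → ℤ → Γ
  | .move .right, c => fun z => c (z + 1)
  | .move .left, c => fun z => c (z - 1)
  | .write s, c => Function.update c 0 s

/-- An infinite run of the machine with transition table `δ`, started in state `q` on the tape `c`: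
after `t` steps the machine is in state `st t` and the tape, numbered relative to the head, is
`tp t`. -/
structure IsRun {Q Γ : Type*} (δ : Q → Γ → Option (Q × TM0.Stmt Γ)) (q : Q) (c : ℤ → Γ)
    (st : ℕ → Q) (tp : ℕ → ℤ → Γ) : Prop where
  st_zero : st 0 = q
  tp_zero : tp 0 = c
  step : ∀ t, ∃ s, δ (st t) (tp t 0) = some (st (t + 1), s) ∧ tp (t + 1) = apply s (tp t)

theorem nth_apply {Γ : Type*} [Inhabited Γ] (s : TM0.Stmt Γ) (T : Tape Γ) :
    (match s with
      | .move d => T.move d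
      | .write a => T.write a : Tape Γ).nth = apply s T.nth := by
  ext z
  rcases s with (_ | _) | a
  · simp [apply]
  · simp [apply]
  · simp [apply, Function.update_apply]

/-- The transition table of a Turing machine, restricted to a set of states that supports it. -/
def restrict {Γ Λ : Type*} [Inhabited Γ] [Inhabited Λ] (M : TM0.Machine Γ Λ)
    (S : Set Λ) (hS : TM0.Supports M S) (q : S) (a : Γ) : Option (S × TM0.Stmt Γ) :=
  (M q a).pmap (fun p hp => (⟨p.1, hp⟩, p.2)) fun p hp => hS.2 (q' := p.1) (s := p.2) hp q.2

theorem restrict_eq_some {Γ Λ : Type*} [Inhabited Γ] [Inhabited Λ] {M : TM0.Machine Γ Λ}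
    {S : Set Λ} {hS : TM0.Supports M S} {q q' : S} {a : Γ} {s : TM0.Stmt Γ} :
    restrict M S hS q a = some (q', s) ↔ M q a = some (q'.1, s) := by
  unfold restrict
  rw [Option.pmap_eq_some_iff]
  constructor
  · rintro ⟨⟨p, s'⟩, hp, h, e⟩
    cases e
    exact h
  · intro h
    exact ⟨(q'.1, s), q'.2, h, rfl⟩

/-- The restricted transition table has an infinite run exactly when the machine does not halt. -/
theorem exists_isRun_iff {Γ Λ : Type*} [Inhabited Γ] [Inhabited Λ] (M : TM0.Machine Γ Λ)
    (S : Set Λ) (hS : TM0.Supports M S) (T : Tape Γ) :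
    (∃ st tp, IsRun (restrict M S hS) ⟨default, hS.1⟩ T.nth st tp) ↔
      ¬ (StateTransition.eval (TM0.step M) ⟨default, T⟩).Dom := by
  constructor
  · rintro ⟨st, tp, h⟩ hd
    obtain ⟨c, hc⟩ := Part.dom_iff_mem.1 hd
    obtain ⟨hr, hn⟩ := StateTransition.mem_eval.1 hc
    have key : ∀ c, StateTransition.Reaches (TM0.step M) ⟨default, T⟩ c →
        ∃ t, c.q = st t ∧ c.Tape.nth = tp t := by
      intro c hr
      induction hr with
      | refl => exact ⟨0, by simp [h.st_zero], by simp [h.tp_zero]⟩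
      | @tail c d _ hd ih =>
        obtain ⟨t, hq, ht⟩ := ih
        obtain ⟨s, h1, h2⟩ := h.step t
        refine ⟨t + 1, ?_⟩
        rw [restrict_eq_some] at h1
        rw [Option.mem_def, TM0.step, hq, ← Tape.nth_zero, ht, h1] at hd
        cases hd
        exact ⟨rfl, (nth_apply s c.Tape).trans (by rw [h2, ht])⟩
    obtain ⟨t, hq, ht⟩ := key c hr
    obtain ⟨s, h1, h2⟩ := h.step t
    rw [restrict_eq_some] at h1
    rw [TM0.step, hq, ← Tape.nth_zero, ht, h1] at hn
    cases hn
  · intro hd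
    have hstep : ∀ c, StateTransition.Reaches (TM0.step M) ⟨default, T⟩ c →
        ∃ d, TM0.step M c = some d := by
      intro c hr
      by_contra hn
      exact hd (Part.dom_iff_mem.2 ⟨c, StateTransition.mem_eval.2
        ⟨hr, Option.eq_none_iff_forall_ne_some.2 fun d h => hn ⟨d, h⟩⟩⟩)
    let cfg : ℕ → TM0.Cfg Γ Λ := fun t => (fun c => (TM0.step M c).getD c)^[t] ⟨default, T⟩
    have hr : ∀ t, StateTransition.Reaches (TM0.step M) ⟨default, T⟩ (cfg t) ∧ (cfg t).q ∈ S ∧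
        TM0.step M (cfg t) = some (cfg (t + 1)) := by
      have hs : ∀ t, StateTransition.Reaches (TM0.step M) ⟨default, T⟩ (cfg t) →
          TM0.step M (cfg t) = some (cfg (t + 1)) := by
        intro t h
        obtain ⟨d, hd⟩ := hstep _ h
        simp only [cfg] at hd ⊢
        rw [Function.iterate_succ_apply', hd]
        rfl
      intro t
      induction t with
      | zero => exact ⟨.refl, hS.1, hs 0 .refl⟩
      | succ t ih =>
        obtain ⟨h1, h2, h3⟩ := ih
        have h4 := h1.tail h3
        exact ⟨h4, TM0.step_supports M hS h3 h2, hs _ h4⟩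
    refine ⟨fun t => ⟨(cfg t).q, (hr t).2.1⟩, fun t => (cfg t).Tape.nth, rfl, rfl, fun t => ?_⟩
    obtain ⟨⟨q', s⟩, h6, h7⟩ := Option.map_eq_some_iff.1
      (show (M (cfg t).q (cfg t).Tape.1).map _ = _ from (hr t).2.2)
    refine ⟨s, restrict_eq_some.2 ?_, ?_⟩
    · simp only [← h7]
      exact h6
    · rw [← h7]
      exact nth_apply s (cfg t).Tape

/-- Every stack machine with finitely many accessible labels is simulated by a machine with a single
two-sided tape. If stack `k` holds `S k`, the tape carries, from the head to the right, the columns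
`fun k => (S k).reverse[i]?`, and a marker on the first one. -/
theorem exists_isRun_iff_of_stacks {K Λ σ : Type} {Γ : K → Type} [DecidableEq K] [Inhabited Λ]
    [Inhabited σ] [Fintype σ] (M : Λ → TM2.Stmt Γ Λ σ) (S : Finset Λ) (hS : TM2.Supports M S) :
    ∃ (Q : Type) (_ : Finite Q) (δ : Q → TM2to1.Γ' K Γ →
        Option (Q × TM0.Stmt (TM2to1.Γ' K Γ))) (q₀ : Q),
      ∀ (stk : ∀ k, List (Γ k)) (L : Turing.ListBlank (∀ k, Option (Γ k))),
        (∀ k, L.map (proj k) = ListBlank.mk ((stk k).map some).reverse) →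
        ((∃ st tp, IsRun δ q₀ (Tape.mk' ∅ (TM2to1.addBottom L)).nth st tp) ↔
          ¬ (StateTransition.eval (TM2.step M) ⟨some default, default, stk⟩).Dom) := by
  have h1 := TM2to1.tr_supports M hS
  have h0 := TM1to0.tr_supports (TM2to1.tr M) h1
  refine ⟨_, inferInstanceAs (Finite (TM1to0.trStmts (TM2to1.tr M) (TM2to1.trSupp M S))),
    restrict _ _ h0, ⟨default, h0.1⟩, fun stk L hL => ?_⟩
  rw [exists_isRun_iff, not_iff_not]
  have e2 := StateTransition.tr_eval_dom (TM2to1.tr_respects M)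
    (TM2to1.TrCfg.mk (q := some default) (v := default) (S := stk) L hL)
  have e1 := StateTransition.tr_eval_dom (TM1to0.tr_respects (TM2to1.tr M))
    (a₁ := ⟨some default, default, Tape.mk' ∅ (TM2to1.addBottom L)⟩) rfl
  exact e1.trans e2

/-- The number `2 ^ n - 1` is written with `n` ones: binary notation becomes unary. -/
theorem trNat_two_pow_sub_one (n : ℕ) :
    PartrecToTM2.trNat (2 ^ n - 1) = List.replicate n PartrecToTM2.Γ'.bit1 := by
  induction n with
  | zero => simp
  | succ n ih =>
    have : 2 ^ (n + 1) - 1 = 2 * (2 ^ n - 1) + 1 := by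
      have := Nat.one_le_two_pow (n := n)
      rw [pow_succ]; omega
    rw [this, List.replicate_succ, ← ih, PartrecToTM2.trNat, PartrecToTM2.trNat]
    have h : (((2 * (2 ^ n - 1) + 1 : ℕ)) : Num) = Num.bit1 ((2 ^ n - 1 : ℕ) : Num) := by
      rw [← Num.ofNat'_eq, ← Num.ofNat'_eq]
      rw [show 2 * (2 ^ n - 1) + 1 = Nat.bit true (2 ^ n - 1) by simp [Nat.bit], Num.ofNat'_bit]
      rfl
    rw [h]
    cases ((2 ^ n - 1 : ℕ) : Num) <;> rfl

/-- The tape with `a` under the head, `b` on the next `n` cells to the right and blanks elsewhere. -/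
def unaryTape {Γ : Type*} (a b blank : Γ) (n : ℕ) (z : ℤ) : Γ :=
  if z = 0 then a else if 0 < z ∧ z ≤ n then b else blank

/-- The halting problem on inputs `2 ^ n - 1`. These inputs are chosen because their binary notation
is a unary notation of `n`, which a tape described by a chain of `n` game states can carry. -/
theorem exists_code_halting : ∃ c : ToPartrec.Code, ∀ n : ℕ,
    (c.eval [2 ^ n - 1]).Dom ↔ (Nat.Partrec.Code.eval (Denumerable.ofNat _ n) 0).Dom := by
  let g : ℕ →. ℕ := fun m => (Nat.rfind fun k => Part.some (decide (2 ^ k = m + 1))).bind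
    fun k => Nat.Partrec.Code.eval (Denumerable.ofNat _ k) 0
  have hg : Partrec g := by
    refine Partrec.bind (Partrec.rfind ?_) ?_
    · refine Computable.partrec (f := fun p : ℕ × ℕ => decide (2 ^ p.2 = p.1 + 1)) ?_
      have hp : Primrec fun k : ℕ => 2 ^ k :=
        (Primrec.nat_rec₁ 1 (Primrec.nat_mul.comp₂ Primrec₂.right (Primrec₂.const 2))).of_eq
          fun k => by
            induction k with
            | zero => rfl
            | succ k ih => rw [pow_succ, ← ih]
      exact (Primrec.eq.comp (hp.comp Primrec.snd) (Primrec.succ.comp Primrec.fst)).decide.to_comp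
    · refine Nat.Partrec.Code.eval_part.comp ?_ (Computable.const 0)
      exact (Computable.ofNat _).comp Computable.snd
  obtain ⟨c, hc⟩ := ToPartrec.Code.exists_code (Nat.Partrec'.part_iff₁.2 hg)
  refine ⟨c, fun n => ?_⟩
  have := hc ⟨[2 ^ n - 1], rfl⟩
  simp only at this
  rw [this]
  have hn : Nat.rfind (fun k => Part.some (decide (2 ^ k = (2 ^ n - 1) + 1))) = Part.some n := by
    rw [Nat.sub_add_cancel Nat.one_le_two_pow]
    refine Part.eq_some_iff.2 (Nat.mem_rfind.2 ⟨by simp, fun {m} hm => ?_⟩)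
    simp only [Part.mem_some_iff]
    symm
    simpa using hm.ne
  change (Part.map pure (g (2 ^ n - 1))).Dom ↔ _
  simp only [g, hn, Part.bind_some]
  rfl

/-- There is a fixed machine for which no algorithm decides from `n` whether it runs forever on the
unary input `n`. -/
theorem exists_undecidable_machine :
    ∃ (Q Γ : Type) (_ : Finite Q) (_ : Finite Γ) (δ : Q → Γ → Option (Q × TM0.Stmt Γ)) (q₀ : Q)
      (a b blank : Γ), ¬ ∃ f : ℕ → Bool, Computable f ∧
        ∀ n, f n = true ↔ ∃ st tp, IsRun δ q₀ (unaryTape a b blank n) st tp := by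
  obtain ⟨c, hc⟩ := exists_code_halting
  obtain ⟨Q, hQ, δ, q₀, h⟩ := @exists_isRun_iff_of_stacks _ _ _ _ _
    ⟨PartrecToTM2.trNormal c .halt⟩ _ _ PartrecToTM2.tr _ (PartrecToTM2.tr_supports c .halt)
  let col : PartrecToTM2.Γ' → ∀ _ : PartrecToTM2.K', Option PartrecToTM2.Γ' :=
    fun s k => if k = .main then some s else none
  have : Fintype PartrecToTM2.K' := ⟨{.main, .rev, .aux, .stack}, fun k => by cases k <;> simp⟩
  refine ⟨Q, _, hQ, inferInstanceAs (Finite (Bool × (PartrecToTM2.K' → Option PartrecToTM2.Γ'))),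
    δ, q₀, (true, col .cons), (false, col .bit1), (false, fun _ => none), ?_⟩
  rintro ⟨f, hf, hfn⟩
  refine ComputablePred.halting_problem 0 (ComputablePred.computable_iff.2
    ⟨fun p => !f (Encodable.encode p), ?_, ?_⟩)
  · exact Primrec.not.to_comp.comp (hf.comp Computable.encode)
  funext p
  have hstk : ∀ n : ℕ, ∀ k : PartrecToTM2.K',
      (ListBlank.mk (col .cons :: List.replicate n (col .bit1))).map (proj k) =
        ListBlank.mk ((PartrecToTM2.K'.elim (PartrecToTM2.trList [2 ^ n - 1]) [] [] [] k).map
          some).reverse := by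
    intro n k
    cases k <;> refine ListBlank.ext fun i => ?_ <;>
      simp [ListBlank.map_mk, col, proj, PartrecToTM2.K'.elim, trNat_two_pow_sub_one]
    all_goals
      rw [List.getI_eq_getElem?_getD]
      cases i
      · rfl
      · rw [List.getElem?_cons_succ, List.getElem?_replicate]
        split_ifs <;> rfl
  have htape : ∀ n : ℕ, (Tape.mk' ∅ (TM2to1.addBottom
      (ListBlank.mk (col .cons :: List.replicate n (col .bit1))))).nth =
      unaryTape (true, col .cons) (false, col .bit1) (false, fun _ => none) n := by
    intro n
    ext1 z
    rcases z with (_ | m) | m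
    · rw [Int.ofNat_eq_natCast, Tape.mk'_nth_nat, ListBlank.nth_zero]
      refine Prod.ext (TM2to1.addBottom_head_fst _) ?_
      rw [← ListBlank.nth_zero, TM2to1.addBottom_nth_snd]
      rfl
    · have hm : (0 : ℤ) < (m + 1 : ℕ) ∧ ((m + 1 : ℕ) : ℤ) ≤ n ↔ m < n := by omega
      rw [Int.ofNat_eq_natCast, Tape.mk'_nth_nat, unaryTape, if_neg (by omega), if_congr hm rfl rfl]
      refine Prod.ext ((TM2to1.addBottom_nth_succ_fst _ _).trans (by split_ifs <;> rfl)) ?_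
      rw [TM2to1.addBottom_nth_snd, ListBlank.nth_mk, List.getI_eq_getElem?_getD,
        List.getElem?_cons_succ, List.getElem?_replicate]
      split_ifs <;> rfl
    · rw [unaryTape, if_neg (by omega), if_neg (by omega)]
      rfl
  have := h _ _ (hstk (Encodable.encode p))
  rw [htape] at this
  replace this := (hfn _).trans this
  have e := PartrecToTM2.tr_eval c [2 ^ (Encodable.encode p) - 1]
  have hn := hc (Encodable.encode p)
  rw [Denumerable.ofNat_encode] at hn
  rw [eq_iff_iff, ← hn, Bool.not_eq_true']
  change _ ↔ ¬ (StateTransition.eval (TM2.step PartrecToTM2.tr) (PartrecToTM2.init c _)).Dom at this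
  rw [e] at this
  rw [← Bool.not_eq_true, this, not_not]
  rfl

end TapeRun

/-! ### The consistency game of a machine -/

namespace TapeGame

open Turing TapeRun

/-- The symbols that the second player is still expected to name before the answers of the first
player become the expected ones; `none` stands for a symbol that is not checked. -/
inductive Queue (Γ : Type) : Type
  | nil
  | one (x : Option Γ)
  | two (x y : Option Γ)

namespace Queue

variable {Γ : Type}

/-- Append the answer of the first player. -/
def push (p : Γ) : Queue Γ → Queue Γ
  | nil => nil
  | one _ => one (some p)
  | two _ y => two y (some p)

/-- The symbol that the second player is expected to name when the first one names `p`. -/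
def front (p : Γ) : Queue Γ → Option Γ
  | nil => some p
  | one x => x
  | two x _ => x

/-- The queue after the first player has given `k` of the answers `p`. -/
def after (p : ℕ → Γ) (u : Queue Γ) : ℕ → Queue Γ
  | 0 => u
  | k + 1 => (after p u k).push (p k)

/-- The answers `p` and `r` of the two players, given synchronously from now on, pass all checks. -/
def Passes (u : Queue Γ) (p r : ℕ → Γ) : Prop :=
  ∀ k, (u.after p k).front (p k) = none ∨ (u.after p k).front (p k) = some (r k)

theorem after_push (p : ℕ → Γ) (u : Queue Γ) (k : ℕ) :
    (u.push (p 0)).after (fun j => p (j + 1)) k = u.after p (k + 1) := by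
  induction k with
  | zero => rfl
  | succ k ih => rw [after, ih]; rfl

theorem Passes.push {u : Queue Γ} {p r : ℕ → Γ} (h : u.Passes p r) :
    (u.push (p 0)).Passes (fun j => p (j + 1)) fun j => r (j + 1) := by
  intro k
  rw [after_push]
  exact h (k + 1)

theorem after_nil (p : ℕ → Γ) (k : ℕ) : nil.after p k = nil := by
  induction k with
  | zero => rfl
  | succ k ih => rw [after, ih]; rfl

theorem passes_nil {p r : ℕ → Γ} : nil.Passes p r ↔ ∀ k, r k = p k := by
  simp [Passes, after_nil, front, eq_comm]

theorem after_one (x : Option Γ) (p : ℕ → Γ) (k : ℕ) :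
    (one x).after p (k + 1) = one (some (p k)) := by
  induction k with
  | zero => rfl
  | succ k ih => rw [after, ih]; rfl

theorem after_two (x y : Option Γ) (p : ℕ → Γ) (k : ℕ) :
    (two x y).after p (k + 1 + 1) = two (some (p k)) (some (p (k + 1))) := by
  induction k with
  | zero => rfl
  | succ k ih => rw [after, ih]; rfl

theorem passes_one {x : Γ} {p r : ℕ → Γ} :
    (one (some x)).Passes p r ↔ r 0 = x ∧ ∀ k, r (k + 1) = p k := by
  rw [Passes, ← Nat.and_forall_add_one]
  simp only [after_one, front]
  simp [after, eq_comm]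

theorem passes_two {x : Γ} {p r : ℕ → Γ} :
    (two none (some x)).Passes p r ↔ r 1 = x ∧ ∀ k, r (k + 2) = p k := by
  rw [Passes, ← Nat.and_forall_add_one, ← Nat.and_forall_add_one]
  simp only [after_two, front]
  simp [after, push, eq_comm]

instance [Finite Γ] : Finite (Queue Γ) := by
  let f : Queue Γ → Option (Option Γ × Option (Option Γ)) := fun u =>
    match u with
    | nil => none
    | one x => some (x, none)
    | two x y => some (x, some y)
  refine Finite.of_injective f fun u v h => ?_
  cases u <;> cases v <;> simp_all [f]

end Queue

/-- The states of the game that do not depend on the input: the initial state, the states `run q`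
in which the machine state is `q`, the states `cmp side late u` in which the answers of the two
players about the cells on one side of the head are compared, the states `vfy e` in which the answer
has to be `e`, the state `neg` in which the cells to the left of the head are blank, and the two
outcomes. The flag `late` says that the last signal told only the first player to leave the head. -/
inductive Base (Q Γ : Type) : Type
  | start
  | run (q : Q)
  | cmp (side late : Bool) (u : Queue Γ)
  | vfy (e : Γ)
  | neg
  | acc
  | rej

instance {Q Γ : Type} [Finite Q] [Finite Γ] : Finite (Base Q Γ) := by
  let f : Base Q Γ → Q ⊕ (Bool × Bool × Queue Γ) ⊕ Γ ⊕ Fin 4 := fun s =>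
    match s with
    | .start => .inr (.inr (.inr 0))
    | .run q => .inl q
    | .cmp s d u => .inr (.inl (s, d, u))
    | .vfy e => .inr (.inr (.inl e))
    | .neg => .inr (.inr (.inr 1))
    | .acc => .inr (.inr (.inr 2))
    | .rej => .inr (.inr (.inr 3))
  refine Finite.of_injective f fun u v h => ?_
  cases u <;> cases v <;> simp_all [f]

/-- The states of the game. In the state `chain k` the next `k` cells to the right of the head
carry the symbol of the unary input, and the cells after them are blank. -/
inductive State (Q Γ : Type) : Type
  | base (s : Base Q Γ)
  | chain (k : ℕ)

/-- The signals given to the players: `0` is a time step, `1` and `2` are moves away from the head,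
to the right and to the left. -/
abbrev Signal : Type := Fin 3

/-- The signal for a move away from the head. -/
def away (side : Bool) : Signal := if side then 1 else 2

/-- The direction of a move away from the head. -/
def sgn (side : Bool) : ℤ := if side then 1 else -1

/-- The history that asks for the symbol `k` cells away from the head at time `t`. It has `t + 1`
time steps since the initial state is left with a time step. -/
def hist (side : Bool) (t k : ℕ) : List Signal :=
  List.replicate (t + 1) 0 ++ List.replicate k (away side)

theorem hist_zero (side : Bool) (t : ℕ) : hist side t 0 = hist true t 0 := by
  simp [hist]

theorem hist_succ (side : Bool) (t k : ℕ) : hist side t k ++ [away side] = hist side t (k + 1) := by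
  simp [hist, List.replicate_succ']

theorem hist_tick (t : ℕ) : hist true t 0 ++ [0] = hist true (t + 1) 0 := by
  simp [hist, List.replicate_succ' (n := t + 1)]

variable {Q Γ : Type}

/-- The queue for a comparison of consecutive times, where `h` is the symbol under the head. The
first player starts next to the head at the earlier time, the second one under the head at the later
time. After a move towards the compared side both see the same cells. After a move in the other
direction the second player is two cells behind; its first cell is not checked here, since it is the
start of the comparison on the other side. After a write it is one cell behind, and its first cell
carries the written symbol. -/
def lag (side : Bool) (h : Γ) : TM0.Stmt Γ → Queue Γ
  | .move .right => if side then .nil else .two none (some h)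
  | .move .left => if side then .two none (some h) else .nil
  | .write x => .one (some x)

/-- Truthful answers about consecutive times pass the delayed comparison. -/
theorem passes_lag (s : TM0.Stmt Γ) (c : ℤ → Γ) (side : Bool) :
    (lag side (c 0) s).Passes (fun k => c (sgn side * (k + 1 : ℕ)))
      fun k => apply s c (sgn side * k) := by
  rcases s with (_ | _) | x <;> cases side <;>
    simp only [lag, Queue.passes_nil, Queue.passes_one, Queue.passes_two, apply, sgn,
      Bool.false_eq_true, if_true, if_false]
  · intro k
    congr 1; push_cast; ring
  · refine ⟨by simp, fun k => ?_⟩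
    congr 1; push_cast; ring
  · refine ⟨by simp, fun k => ?_⟩
    congr 1
  · intro k
    rfl
  all_goals
    refine ⟨by simp, fun k => ?_⟩
    rw [Function.update_of_ne (by push_cast; omega)]

/-- The delayed comparisons on both sides of the head determine the next tape. -/
theorem eq_apply_of_passes_lag (s : TM0.Stmt Γ) (c : ℤ → Γ) (r : Bool → ℕ → Γ)
    (h0 : ∀ side, r side 0 = r true 0)
    (h : ∀ side, (lag side (c 0) s).Passes (fun k => c (sgn side * (k + 1 : ℕ))) (r side))
    (side : Bool) (k : ℕ) : r side k = apply s c (sgn side * k) := by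
  have ht := h true
  have hf := h false
  have h0' := h0 false
  rcases s with (_ | _) | x <;>
    simp only [lag, Queue.passes_nil, Queue.passes_one, Queue.passes_two, apply, sgn,
      Bool.false_eq_true, if_true, if_false] at ht hf ⊢
  · cases side
    · rw [hf]
      congr 1; push_cast; ring
    · rcases k with _ | _ | k
      · rw [← h0', hf]; simp
      · rw [ht.1]; simp
      · rw [ht.2]; congr 1; simp only [if_true]; push_cast; ring
  · cases side
    · rcases k with _ | _ | k
      · rw [h0', ht]; simp
      · rw [hf.1]; simp
      · rw [hf.2]; congr 1
    · exact ht k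
  · rcases k with _ | k
    · cases side <;> simp [hf.1, ht.1]
    · cases side
      · rw [hf.2, Function.update_of_ne (by simp; omega)]
        rfl
      · rw [ht.2, Function.update_of_ne (by simp; omega)]
        rfl

variable (δ : Q → Γ → Option (Q × TM0.Stmt Γ)) (q₀ : Q) (a b blank : Γ) (n : ℕ)

open scoped Classical in
/-- The possible successors of a state when the two players answer `p` and `r`. A state `run q`
checks that the answers agree and that the machine does not halt; it is followed by the next machine
state or by a comparison of the answers on one side of the head, at the same time or at consecutive
times. -/
noncomputable def succ : State Q Γ → Γ → Γ → List (State Q Γ)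
  | .base .start, _, _ => [.base (.run q₀), .base (.vfy a), .base .neg, .chain n]
  | .base (.run q), p, r =>
    if p = r then
      match δ q p with
      | none => [.base .rej]
      | some (q', s) => [.base (.run q'), .base (.cmp true false .nil),
          .base (.cmp false false .nil), .base (.cmp true true (lag true p s)),
          .base (.cmp false true (lag false p s))]
    else [.base .rej]
  | .base (.cmp side _ u), p, r =>
    if u.front p = none ∨ u.front p = some r then [.base (.cmp side false (u.push p)), .base .acc]
    else [.base .rej]
  | .base (.vfy e), p, _ => if p = e then [.base .acc] else [.base .rej]
  | .base .neg, _, _ => [.base .neg, .base (.vfy blank)]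
  | .base .acc, _, _ => [.base .acc]
  | .base .rej, _, _ => [.base .rej]
  | .chain 0, _, _ => [.chain 0, .base (.vfy blank)]
  | .chain (k + 1), _, _ => [.chain k, .base (.vfy b)]

/-- The signals given to the two players when the state changes. At the start of a delayed
comparison only the first player leaves the head; the second one takes a time step, and cannot tell
this from the continuation of the run. -/
def signal : State Q Γ → State Q Γ → Signal × Signal
  | .base (.run _), .base (.cmp side true _) => (away side, 0)
  | .base (.run _), .base (.cmp side false _) => (away side, away side)
  | .base (.cmp side _ _), _ => (away side, away side)
  | .base .neg, _ => (2, 2)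
  | .chain _, _ => (1, 1)
  | _, _ => (0, 0)

/-- The pairs of a state and two histories that occur when the players answer according to the
functions `F` and `G`. -/
inductive Reach (F G : List Signal → Γ) : State Q Γ → List Signal → List Signal → Prop
  | start : Reach F G (.base .start) [] []
  | step {s w v s'} : Reach F G s w v → s' ∈ succ δ q₀ a b blank n s (F w) (G v) →
      Reach F G s' (w ++ [(signal s s').1]) (v ++ [(signal s s').2])

/-- What holds at a state of the game, and after histories `w` and `v`, when the players answer
truthfully about the run with states `st` and tapes `tp` by the function `F`. The truncated
difference `n - k` is the number of input symbols left to the right of the position `k`. -/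
def Fits (st : ℕ → Q) (tp : ℕ → ℤ → Γ) (n : ℕ) (F : List Signal → Γ) :
    State Q Γ → List Signal → List Signal → Prop
  | .base .start, w, v => w = [] ∧ v = []
  | .base (.run q), w, v => ∃ t, q = st t ∧ w = hist true t 0 ∧ v = hist true t 0
  | .base (.cmp side _ u), w, v => ∃ t t' k k', w = hist side t k ∧ v = hist side t' k' ∧
      u.Passes (fun j => tp t (sgn side * (k + j : ℕ))) fun j => tp t' (sgn side * (k' + j : ℕ))
  | .base (.vfy e), w, _ => F w = e
  | .base .neg, w, _ => ∃ k, w = hist false 0 k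
  | .chain j, w, _ => ∃ k, w = hist true 0 k ∧ j = n - k
  | .base .acc, _, _ => True
  | .base .rej, _, _ => False

variable {δ q₀ a b blank n} {F G : List Signal → Γ}

/-- If the machine runs forever, then describing its run truthfully is never rejected. -/
theorem exists_passing (st : ℕ → Q) (tp : ℕ → ℤ → Γ)
    (h : IsRun δ q₀ (unaryTape a b blank n) st tp) :
    ∃ F : List Signal → Γ, ∀ s w v, Reach δ q₀ a b blank n F F s w v → s ≠ .base .rej := by
  -- The history encodes the time, shifted by one, and the position.
  let F : List Signal → Γ := fun w =>
    tp (w.count 0 - 1) (w.count 1 - w.count 2)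
  have hF : ∀ side t k, F (hist side t k) = tp t (sgn side * k) := by
    intro side t k
    cases side <;> simp [F, hist, sgn, away, List.count_replicate]
  refine ⟨F, fun s w v hr => ?_⟩
  have inv : Fits st tp n F s w v := by
    induction hr with
    | start => exact ⟨rfl, rfl⟩
    | @step s w v s' hr hs' ih =>
      rcases s with (_ | q | ⟨side, late, u⟩ | e | _ | _ | _) | j
      · obtain ⟨rfl, rfl⟩ := ih
        simp only [succ, List.mem_cons, List.not_mem_nil, or_false] at hs'
        rcases hs' with rfl | rfl | rfl | rfl
        · exact ⟨0, h.st_zero.symm, rfl, rfl⟩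
        · refine (hF true 0 0).trans ?_
          simp [h.tp_zero, unaryTape]
        · exact ⟨0, rfl⟩
        · exact ⟨0, rfl, rfl⟩
      · obtain ⟨t, rfl, rfl, rfl⟩ := ih
        obtain ⟨s, h1, h2⟩ := h.step t
        have hp : F (hist true t 0) = tp t 0 := by simp [hF]
        rw [hp] at hs'
        simp only [succ, if_true, h1, List.mem_cons, List.not_mem_nil, or_false] at hs'
        have hpub : ∀ side, ∃ t' t'' k k', hist true t 0 ++ [away side] = hist side t' k ∧
            hist true t 0 ++ [away side] = hist side t'' k' ∧
            Queue.nil.Passes (fun j => tp t' (sgn side * (k + j : ℕ)))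
              fun j => tp t'' (sgn side * (k' + j : ℕ)) := by
          intro side
          refine ⟨t, t, 1, 1, ?_, ?_, Queue.passes_nil.2 fun _ => rfl⟩ <;>
            rw [← hist_zero side, hist_succ]
        have hlate : ∀ side, ∃ t' t'' k k', hist true t 0 ++ [away side] = hist side t' k ∧
            hist true t 0 ++ [0] = hist side t'' k' ∧
            (lag side (tp t 0) s).Passes (fun j => tp t' (sgn side * (k + j : ℕ)))
              fun j => tp t'' (sgn side * (k' + j : ℕ)) := by
          intro side
          refine ⟨t, t + 1, 1, 0, ?_, ?_, ?_⟩
          · rw [← hist_zero side, hist_succ]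
          · rw [hist_tick, hist_zero side]
          · have := passes_lag s (tp t) side
            rw [h2]
            simpa only [zero_add, add_comm 1] using this
        rcases hs' with rfl | rfl | rfl | rfl | rfl
        · exact ⟨t + 1, rfl, hist_tick t, hist_tick t⟩
        · exact hpub true
        · exact hpub false
        · exact hlate true
        · exact hlate false
      · obtain ⟨t, t', k, k', rfl, rfl, hu⟩ := ih
        have h0 := hu 0
        simp only [Queue.after, add_zero, ← hF] at h0
        simp only [succ, if_pos h0, List.mem_cons, List.not_mem_nil, or_false] at hs'
        rcases hs' with rfl | rfl
        · refine ⟨t, t', k + 1, k' + 1, hist_succ _ _ _, hist_succ _ _ _, ?_⟩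
          have := hu.push
          simp only [add_zero, ← hF] at this ⊢
          simpa only [add_assoc, add_comm 1] using this
        · trivial
      · simp only [succ] at hs'
        rw [if_pos (show F w = e from ih), List.mem_singleton] at hs'
        subst hs'
        trivial
      · obtain ⟨k, rfl⟩ := ih
        simp only [succ, List.mem_cons, List.not_mem_nil, or_false] at hs'
        rcases hs' with rfl | rfl
        · exact ⟨k + 1, hist_succ false _ _⟩
        · refine (congrArg F (hist_succ false 0 k)).trans ?_
          rw [hF, h.tp_zero, unaryTape, if_neg, if_neg] <;> simp [sgn]; omega
      · rw [succ, List.mem_singleton] at hs'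
        subst hs'
        trivial
      · exact ih.elim
      · obtain ⟨k, rfl, hj⟩ := ih
        rcases j with _ | m <;>
          simp only [succ, List.mem_cons, List.not_mem_nil, or_false] at hs' <;>
          rcases hs' with rfl | rfl
        · exact ⟨k + 1, hist_succ true _ _, by omega⟩
        · refine (congrArg F (hist_succ true 0 k)).trans ?_
          rw [hF, h.tp_zero, unaryTape, if_neg, if_neg] <;> simp [sgn] <;> omega
        · exact ⟨k + 1, hist_succ true _ _, by omega⟩
        · refine (congrArg F (hist_succ true 0 k)).trans ?_
          rw [hF, h.tp_zero, unaryTape, if_neg, if_pos] <;> simp [sgn] <;> omega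
  rintro rfl
  exact inv

theorem answer_of_reach_vfy
    (hrej : ∀ s w v, Reach δ q₀ a b blank n F G s w v → s ≠ .base .rej)
    {e : Γ} {w v : List Signal}
    (h : Reach δ q₀ a b blank n F G (.base (.vfy e)) w v) : F w = e := by
  by_contra hn
  exact hrej _ _ _ (h.step (s' := .base .rej) (by simp [succ, hn])) rfl

/-- In an undetected play the first player describes the initial tape truthfully. -/
theorem answer_zero
    (hrej : ∀ s w v, Reach δ q₀ a b blank n F G s w v → s ≠ .base .rej)
    (side : Bool) (k : ℕ) :
    F (hist side 0 k) = unaryTape a b blank n (sgn side * k) := by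
  have hneg : ∀ k, Reach δ q₀ a b blank n F G (.base .neg) (hist false 0 k) (hist false 0 k) := by
    intro k
    induction k with
    | zero => exact Reach.start.step (s' := .base .neg) (by simp [succ])
    | succ k ih =>
      have := ih.step (s' := .base .neg) (by simp [succ])
      rw [← hist_succ]
      exact this
  have hpos : ∀ k, Reach δ q₀ a b blank n F G (.chain (n - k)) (hist true 0 k) (hist true 0 k) := by
    intro k
    induction k with
    | zero => exact Reach.start.step (s' := .chain n) (by simp [succ])
    | succ k ih =>
      have := ih.step (s' := .chain (n - (k + 1))) (by
        rcases hj : n - k with _ | m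
        · rw [show n - (k + 1) = 0 by omega]
          simp [succ]
        · rw [show n - (k + 1) = m by omega]
          simp [succ])
      rw [← hist_succ]
      exact this
  rcases k with _ | k
  · have : Reach δ q₀ a b blank n F G (.base (.vfy a)) [0] [0] :=
      Reach.start.step (s' := .base (.vfy a)) (by simp [succ])
    rw [hist_zero]
    exact (answer_of_reach_vfy hrej this).trans (by simp [unaryTape])
  · cases side
    · have := answer_of_reach_vfy hrej ((hneg k).step (s' := .base (.vfy blank)) (by simp [succ]))
      rw [← hist_succ]
      refine this.trans ?_
      rw [unaryTape, if_neg, if_neg] <;> simp [sgn]; omega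
    · by_cases hk : k < n
      · have := answer_of_reach_vfy hrej ((hpos k).step (s' := .base (.vfy b)) (by
          rw [show n - k = n - k - 1 + 1 by omega]
          simp [succ]))
        rw [← hist_succ]
        refine this.trans ?_
        rw [unaryTape, if_neg, if_pos] <;> simp [sgn] <;> omega
      · have := answer_of_reach_vfy hrej ((hpos k).step (s' := .base (.vfy blank)) (by
          rw [show n - k = 0 by omega]
          simp [succ]))
        rw [← hist_succ]
        refine this.trans ?_
        rw [unaryTape, if_neg, if_neg] <;> simp [sgn] <;> omega

/-- In an undetected play a comparison, once started, is passed at all later cells. -/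
theorem passes_of_reach_cmp
    (hrej : ∀ s w v, Reach δ q₀ a b blank n F G s w v → s ≠ .base .rej)
    {side late : Bool} {u : Queue Γ} {t t' k k' : ℕ}
    (h : Reach δ q₀ a b blank n F G (.base (.cmp side late u)) (hist side t k) (hist side t' k')) :
    u.Passes (fun j => F (hist side t (k + j))) fun j => G (hist side t' (k' + j)) := by
  have hcheck : ∀ {late u t t' k k'}, Reach δ q₀ a b blank n F G (.base (.cmp side late u))
      (hist side t k) (hist side t' k') → u.front (F (hist side t k)) = none ∨
        u.front (F (hist side t k)) = some (G (hist side t' k')) := by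
    intro late u t t' k k' h
    by_contra hn
    exact hrej _ _ _ (h.step (s' := .base .rej) (by rw [succ, if_neg hn]; simp)) rfl
  have hr : ∀ j, ∃ late, Reach δ q₀ a b blank n F G
      (.base (.cmp side late (u.after (fun j => F (hist side t (k + j))) j)))
      (hist side t (k + j)) (hist side t' (k' + j)) := by
    intro j
    induction j with
    | zero => exact ⟨late, h⟩
    | succ j ih =>
      obtain ⟨late', ih⟩ := ih
      have := ih.step (s' := .base (.cmp side false
        (u.after (fun j => F (hist side t (k + j))) (j + 1)))) (by
          rw [succ, if_pos (hcheck ih)]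
          simp [Queue.after])
      rw [← add_assoc, ← add_assoc, ← hist_succ, ← hist_succ]
      exact ⟨_, this⟩
  intro j
  obtain ⟨late', hj⟩ := hr j
  exact hcheck hj

/-- In an undetected play the two players give the same answers. -/
theorem answers_eq
    (hrej : ∀ s w v, Reach δ q₀ a b blank n F G s w v → s ≠ .base .rej)
    {q : Q} {t : ℕ}
    (h : Reach δ q₀ a b blank n F G (.base (.run q)) (hist true t 0) (hist true t 0))
    (side : Bool) (k : ℕ) : G (hist side t k) = F (hist side t k) := by
  have h0 : F (hist true t 0) = G (hist true t 0) := by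
    by_contra hn
    exact hrej _ _ _ (h.step (s' := .base .rej) (by rw [succ, if_neg hn]; simp)) rfl
  rcases k with _ | k
  · rw [hist_zero, h0]
  rcases hδ : δ q (F (hist true t 0)) with _ | ⟨q', s⟩
  · exact (hrej _ _ _ (h.step (s' := .base .rej) (by rw [succ, if_pos h0, hδ]; simp)) rfl).elim
  have h1 := h.step (s' := .base (.cmp side false .nil)) (by
    rw [succ, if_pos h0, hδ]; cases side <;> simp)
  simp only [signal] at h1
  rw [← hist_zero side, hist_succ] at h1
  have := Queue.passes_nil.1 (passes_of_reach_cmp hrej h1) k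
  rwa [add_comm] at this

/-- In an undetected play the answers about time `t + 1` follow from those about time `t`. -/
theorem answers_step
    (hrej : ∀ s w v, Reach δ q₀ a b blank n F G s w v → s ≠ .base .rej)
    {q : Q} {t : ℕ} {c : ℤ → Γ}
    (h : Reach δ q₀ a b blank n F G (.base (.run q)) (hist true t 0) (hist true t 0))
    (hF : ∀ side k, F (hist side t k) = c (sgn side * k)) :
    ∃ q' s, δ q (c 0) = some (q', s) ∧
      Reach δ q₀ a b blank n F G (.base (.run q')) (hist true (t + 1) 0) (hist true (t + 1) 0) ∧
      ∀ side k, F (hist side (t + 1) k) = apply s c (sgn side * k) := by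
  have h0 : F (hist true t 0) = G (hist true t 0) := (answers_eq hrej h true 0).symm
  have hc : F (hist true t 0) = c 0 := by simp [hF]
  rcases hδ : δ q (F (hist true t 0)) with _ | ⟨q', s⟩
  · exact (hrej _ _ _ (h.step (s' := .base .rej) (by rw [succ, if_pos h0, hδ]; simp)) rfl).elim
  have h1 := h.step (s' := .base (.run q')) (by rw [succ, if_pos h0, hδ]; simp)
  simp only [signal, hist_tick] at h1
  refine ⟨q', s, hc ▸ hδ, h1, fun side k => ?_⟩
  rw [← answers_eq hrej h1]
  refine eq_apply_of_passes_lag s c (fun side k => G (hist side (t + 1) k))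
    (fun side => by rw [hist_zero side]) (fun side => ?_) side k
  have h2 := h.step (s' := .base (.cmp side true (lag side (c 0) s))) (by
    rw [succ, if_pos h0, hδ, hc]; cases side <;> simp)
  simp only [signal, hist_tick] at h2
  rw [← hist_zero side, hist_succ, ← hist_zero side] at h2
  have := passes_of_reach_cmp hrej h2
  simp only [hF, zero_add] at this
  simpa only [add_comm 1] using this

/-- If no play is rejected, then the answers describe an infinite run. -/
theorem exists_isRun
    (hrej : ∀ s w v, Reach δ q₀ a b blank n F G s w v → s ≠ .base .rej) :
    ∃ st tp, IsRun δ q₀ (unaryTape a b blank n) st tp := by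
  let tp : ℕ → ℤ → Γ := fun t z => F (hist (decide (0 ≤ z)) t z.natAbs)
  have htp : ∀ t side (k : ℕ), F (hist side t k) = tp t (sgn side * k) := by
    intro t side k
    rcases k with _ | k
    · simp [tp, hist]
    · cases side
      · have : ¬ (0 : ℤ) ≤ sgn false * (k + 1 : ℕ) := by simp [sgn]; omega
        simp only [tp, this, decide_false]
        congr 2
        simp [sgn]; omega
      · have : (0 : ℤ) ≤ sgn true * (k + 1 : ℕ) := by simp [sgn]; omega
        simp only [tp, this, decide_true]
        congr 2
        simp [sgn]; omega
  let st : ℕ → Q := fun t => Nat.rec q₀ (fun t q => ((δ q (tp t 0)).map Prod.fst).getD q) t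
  have hsurj : ∀ z : ℤ, ∃ side, ∃ k : ℕ, z = sgn side * k := by
    intro z
    rcases le_total 0 z with h | h
    · exact ⟨true, z.natAbs, by simp [sgn, abs_of_nonneg h]⟩
    · exact ⟨false, z.natAbs, by simp [sgn, abs_of_nonpos h]⟩
  have hr : ∀ t, Reach δ q₀ a b blank n F G (.base (.run (st t))) (hist true t 0)
      (hist true t 0) := by
    intro t
    induction t with
    | zero => exact Reach.start.step (s' := .base (.run q₀)) (by simp [succ])
    | succ t ih =>
      obtain ⟨q', s, h1, h2, -⟩ := answers_step hrej ih (htp t)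
      have : st (t + 1) = q' := by
        simp only [st] at h1 ⊢
        rw [h1]
        rfl
      rwa [this]
  refine ⟨st, tp, rfl, ?_, fun t => ?_⟩
  · ext z
    obtain ⟨side, k, rfl⟩ := hsurj z
    rw [← htp, answer_zero hrej]
  · obtain ⟨q', s, h1, h2, h3⟩ := answers_step hrej (hr t) (htp t)
    refine ⟨s, ?_, ?_⟩
    · have : st (t + 1) = q' := by
        simp only [st] at h1 ⊢
        rw [h1]
        rfl
      rw [this, h1]
    · ext z
      obtain ⟨side, k, rfl⟩ := hsurj z
      rw [← htp, h3]

end TapeGame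

/-! ### Finite descriptions of the games -/

/-- Only the support of a distribution given by weights matters in the sequel. -/
theorem weightPMF_ne_zero_iff {α : Type} [Fintype α] {w : α → ℕ} {hw : 0 < ∑ a, w a} {x : α} :
    weightPMF w hw x ≠ 0 ↔ w x ≠ 0 := by
  change (w x : ℝ≥0∞) / ((∑ b, w b : ℕ) : ℝ≥0∞) ≠ 0 ↔ _
  simp [ENNReal.div_eq_zero_iff]

theorem DecPOMDPCode.weight_ne_zero_iff {K : Type} [DecidableEq K] {l : List (K × ℕ)} {key : K} :
    DecPOMDPCode.weight l key ≠ 0 ↔ ∃ w, (key, w) ∈ l ∧ w ≠ 0 := by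
  rw [DecPOMDPCode.weight, Ne, List.sum_eq_zero_iff]
  simp

namespace TapeGame

open Turing TapeRun

variable {Q Γ : Type}

/-- A bound for the number of further phases of the game. Every phase before the outcome is
left with positive probability in each step, so that the game ends almost surely. -/
def rank : State Q Γ → ℕ
  | .base .start => 4
  | .base (.run _) => 3
  | .base .neg => 2
  | .chain _ => 2
  | .base (.cmp _ _ _) => 1
  | .base (.vfy _) => 1
  | .base .acc => 0
  | .base .rej => 0

section

variable {δ : Q → Γ → Option (Q × TM0.Stmt Γ)} {q₀ : Q} {a b blank : Γ} {n : ℕ}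

theorem rank_le_of_mem_succ {s s' : State Q Γ} {p r : Γ}
    (h : s' ∈ succ δ q₀ a b blank n s p r) : rank s' ≤ rank s := by
  rcases s with (_ | q | ⟨side, late, u⟩ | e | _ | _ | _) | _ | k <;> simp only [succ] at h
  case base.run =>
    split_ifs at h
    · split at h <;> simp at h
      · subst h; simp [rank]
      · rcases h with rfl | rfl | rfl | rfl | rfl <;> simp [rank]
    · simp at h
      subst h; simp [rank]
  case base.cmp =>
    split_ifs at h <;> simp at h
    · rcases h with rfl | rfl <;> simp [rank]
    · subst h; simp [rank]
  case base.vfy =>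
    split_ifs at h <;> simp at h <;> subst h <;> simp [rank]
  all_goals
    simp at h
    rcases h with rfl | rfl | rfl | rfl <;> simp [rank]

theorem exists_rank_lt (s : State Q Γ) (p r : Γ) (hacc : s ≠ .base .acc) (hrej : s ≠ .base .rej) :
    ∃ s' ∈ succ δ q₀ a b blank n s p r, rank s' < rank s := by
  rcases s with (_ | q | ⟨side, late, u⟩ | e | _ | _ | _) | _ | k <;> simp only [succ]
  case base.run =>
    split_ifs
    · split <;> simp [rank]
    · simp [rank]
  all_goals first
    | contradiction
    | (split_ifs <;> simp [rank])
    | simp [rank]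

end

/-- The data needed to write down the games of a machine for `n` players: numberings of the machine
symbols and of the game states that do not depend on the input, and the machine with its input
symbols. -/
structure Numbering (n : ℕ) (Q Γ : Type) where
  two_le : 2 ≤ n
  numBase : ℕ
  base : Base Q Γ ≃ Fin numBase
  numSym : ℕ
  sym : Γ ≃ Fin numSym
  δ : Q → Γ → Option (Q × TM0.Stmt Γ)
  q₀ : Q
  fst : Γ
  rest : Γ
  blank : Γ

namespace Numbering

variable {n : ℕ} (N : Numbering n Q Γ)

/-- The number of a game state. The states that depend on the input come last, so that the tables
of the games differ only in entries that are easily computed from the input. -/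
def enc : State Q Γ → ℕ
  | .base s => N.base s
  | .chain k => N.numBase + k

/-- The game state with a given number, on all natural numbers: the inverse of `enc`. -/
def dec (x : ℕ) : State Q Γ :=
  if h : x < N.numBase then .base (N.base.symm ⟨x, h⟩) else .chain (x - N.numBase)

@[simp]
theorem enc_dec (x : ℕ) : N.enc (N.dec x) = x := by
  unfold dec
  split_ifs with h
  · simp [enc]
  · simp only [enc]; omega

@[simp]
theorem dec_enc (s : State Q Γ) : N.dec (N.enc s) = s := by
  cases s <;> simp [enc, dec]

theorem enc_injective : Function.Injective N.enc :=
  Function.LeftInverse.injective N.dec_enc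

/-- The first of the two players whose answers matter; the actions of all further players are
ignored. -/
def player₀ : Fin n := ⟨0, by have := N.two_le; omega⟩

/-- The second of the two players whose answers matter. -/
def player₁ : Fin n := ⟨1, by have := N.two_le; omega⟩

/-- The successors of a state in the game for the input `j`. -/
noncomputable def next (j : ℕ) (s : State Q Γ) (a : Fin n → Fin N.numSym) : List (State Q Γ) :=
  succ N.δ N.q₀ N.fst N.rest N.blank j s (N.sym.symm (a N.player₀)) (N.sym.symm (a N.player₁))

/-- The global observation for a pair of signals. -/
def obsOf (p : Signal × Signal) (i : Fin n) : ℕ :=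
  if i = N.player₀ then p.1 else p.2

/-- A joint action as a tuple of numbers. -/
def actNum (a : Fin n → Fin N.numSym) (i : Fin n) : ℕ := a i

theorem actNum_injective : Function.Injective N.actNum := fun _ _ h =>
  funext fun i => Fin.ext (congrFun h i)

/-- All joint actions. -/
noncomputable def acts : List (Fin n → ℕ) :=
  (Finset.univ : Finset (Fin n → Fin N.numSym)).toList.map N.actNum

/-- All game states that do not depend on the input. -/
noncomputable def bases : List (Base Q Γ) :=
  (Finset.univ : Finset (Fin N.numBase)).toList.map N.base.symm

theorem mem_acts {a : Fin n → ℕ} : a ∈ N.acts ↔ ∃ a', N.actNum a' = a := by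
  simp [acts]

theorem mem_bases (s : Base Q Γ) : s ∈ N.bases :=
  List.mem_map.2 ⟨N.base s, by simp, by simp⟩

/-- The transitions between states that do not depend on the input. -/
noncomputable def baseTrans : List ((ℕ × (Fin n → ℕ) × ℕ) × ℕ) :=
  N.bases.flatMap fun s => (Finset.univ : Finset (Fin n → Fin N.numSym)).toList.flatMap fun a =>
    ((N.next 0 (.base s) a).map N.enc |>.filter (· < N.numBase)).map fun y =>
      ((N.enc (.base s), N.actNum a, y), 1)

/-- The transitions of the game for the input `j`. -/
noncomputable def trans (j : ℕ) : List ((ℕ × (Fin n → ℕ) × ℕ) × ℕ) :=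
  N.baseTrans ++ (N.acts.map fun a => ((N.enc (.base .start), a, N.numBase + j), 1)) ++
    (N.acts.flatMap fun a => [((N.numBase, a, N.numBase), 1),
      ((N.numBase, a, N.enc (.base (.vfy N.blank))), 1)]) ++
    (List.range j).flatMap fun k => N.acts.flatMap fun a =>
      [((N.numBase + k + 1, a, N.numBase + k), 1),
        ((N.numBase + k + 1, a, N.enc (.base (.vfy N.rest))), 1)]

/-- The observations for pairs of states that do not depend on the input. -/
noncomputable def baseObs : List ((ℕ × (Fin n → ℕ) × ℕ × (Fin n → ℕ)) × ℕ) :=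
  N.bases.flatMap fun s => N.bases.flatMap fun s' => N.acts.map fun a =>
    ((N.enc (.base s), a, N.enc (.base s'), N.obsOf (signal (.base s) (.base s'))), 1)

/-- The observations when a state that depends on the input is entered. -/
noncomputable def entryObs : List (ℕ × (Fin n → ℕ) × (Fin n → ℕ)) :=
  N.bases.flatMap fun s => N.acts.map fun a =>
    (N.enc (.base s), a, N.obsOf (signal (.base s) (.chain 0)))

/-- The observations of the game for the input `j`. -/
noncomputable def obs (j : ℕ) : List ((ℕ × (Fin n → ℕ) × ℕ × (Fin n → ℕ)) × ℕ) :=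
  N.baseObs ++
    ((List.range (j + 1)).flatMap fun k => N.entryObs.map fun t =>
      ((t.1, t.2.1, N.numBase + k, t.2.2), 1)) ++
    (List.range (j + 1)).flatMap fun k => (List.range (N.numBase + (j + 1))).flatMap fun y =>
      N.acts.map fun a => ((N.numBase + k, a, y, N.obsOf (1, 1)), 1)

/-- The description of the game for the input `j`. Each possible transition has a positive weight;
the exact probabilities are irrelevant. -/
noncomputable def code (j : ℕ) : DecPOMDPCode n where
  numStates := N.numBase + (j + 1)
  numActs _ := N.numSym
  numObs _ := 3
  init := N.enc (.base .start)
  trans := N.trans j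
  obs := N.obs j
  target := [N.enc (.base .acc)]

theorem computable_code : Computable N.code := by
  have hadd : ∀ {α : Type} [Primcodable α] {f : α → ℕ}, Primrec f →
      Primrec fun x => N.numBase + f x := fun hf => Primrec.nat_add.comp (Primrec.const _) hf
  have htrans : Primrec N.trans := by
    refine Primrec.list_append.comp (Primrec.list_append.comp (Primrec.list_append.comp
      (Primrec.const _) ?_) (Primrec.const _)) ?_
    · refine Primrec.list_map (Primrec.const _) ?_
      exact Primrec.pair (Primrec.pair (Primrec.const _) (Primrec.pair Primrec.snd
        (hadd Primrec.fst))) (Primrec.const 1)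
    · refine Primrec.list_flatMap Primrec.list_range ?_
      refine Primrec.list_flatMap (Primrec.const _) ?_
      have hk : Primrec fun x : (ℕ × ℕ) × (Fin n → ℕ) => N.numBase + x.1.2 :=
        hadd (Primrec.snd.comp Primrec.fst)
      have hentry : ∀ {f : (ℕ × ℕ) × (Fin n → ℕ) → ℕ}, Primrec f →
          Primrec fun x => ((N.numBase + x.1.2 + 1, x.2, f x), 1) := fun hf =>
        Primrec.pair (Primrec.pair (Primrec.succ.comp hk) (Primrec.pair Primrec.snd hf))
          (Primrec.const 1)
      exact Primrec.list_cons.comp (hentry hk) (Primrec.list_cons.comp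
        (hentry (Primrec.const _)) (Primrec.const []))
  have hobs : Primrec N.obs := by
    refine Primrec.list_append.comp (Primrec.list_append.comp (Primrec.const _) ?_) ?_
    · refine Primrec.list_flatMap (Primrec.list_range.comp Primrec.succ) ?_
      refine Primrec.list_map (Primrec.const _) ?_
      exact Primrec.pair (Primrec.pair (Primrec.fst.comp Primrec.snd)
        (Primrec.pair (Primrec.fst.comp (Primrec.snd.comp Primrec.snd))
          (Primrec.pair (hadd (Primrec.snd.comp Primrec.fst))
            (Primrec.snd.comp (Primrec.snd.comp Primrec.snd))))) (Primrec.const 1)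
    · refine Primrec.list_flatMap (Primrec.list_range.comp Primrec.succ) ?_
      refine Primrec.list_flatMap (Primrec.list_range.comp
        (hadd (Primrec.succ.comp Primrec.fst))) ?_
      refine Primrec.list_map (Primrec.const _) ?_
      exact Primrec.pair (Primrec.pair (hadd (Primrec.snd.comp (Primrec.fst.comp Primrec.fst)))
        (Primrec.pair Primrec.snd (Primrec.pair (Primrec.snd.comp Primrec.fst)
          (Primrec.const _)))) (Primrec.const 1)
  have htuple : Primrec fun j => DecPOMDPCode.equivTuple n (N.code j) :=
    Primrec.pair (hadd Primrec.succ) (Primrec.pair (Primrec.const _) (Primrec.pair (Primrec.const _)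
      (Primrec.pair (Primrec.const _) (Primrec.pair htrans (Primrec.pair hobs
        (Primrec.const _))))))
  exact ((Primrec.of_equiv_iff (DecPOMDPCode.equivTuple n)).1 htuple).to_comp

theorem enc_lt_iff {s : State Q Γ} : N.enc s < N.numBase ↔ ∃ b, s = .base b := by
  cases s <;> simp [enc]

/-- The only transition from a state of `Base` that depends on the input is the one from the
initial state into the chain. -/
theorem mem_next_base {s : Base Q Γ} {s' : State Q Γ} {j : ℕ} {a : Fin n → Fin N.numSym} :
    s' ∈ N.next j (.base s) a ↔ (s' ∈ N.next 0 (.base s) a ∧ N.enc s' < N.numBase) ∨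
      (s = .start ∧ s' = .chain j) := by
  rw [enc_lt_iff]
  rcases s with _ | q | ⟨side, late, u⟩ | e | _ | _ | _ <;> simp only [next, succ]
  case run =>
    split_ifs
    · split <;> simp +contextual [or_imp]
    · simp +contextual
  all_goals
    first
      | (split_ifs <;> simp +contextual [or_imp])
      | (simp +contextual [or_imp]; try aesop)

theorem mem_trans {j : ℕ} {s s' : State Q Γ} {a : Fin n → Fin N.numSym}
    (hs : N.enc s < N.numBase + (j + 1)) :
    (∃ w, ((N.enc s, N.actNum a, N.enc s'), w) ∈ N.trans j ∧ w ≠ 0) ↔ s' ∈ N.next j s a := by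
  have hbase : ((N.enc s, N.actNum a, N.enc s'), 1) ∈ N.baseTrans ↔
      ∃ b, s = .base b ∧ s' ∈ N.next 0 s a ∧ N.enc s' < N.numBase := by
    simp only [baseTrans, List.mem_flatMap, List.mem_map, List.mem_filter, Finset.mem_toList,
      Finset.mem_univ, true_and, Prod.mk.injEq, and_true, decide_eq_true_eq]
    constructor
    · rintro ⟨b, -, a', y, ⟨⟨s'', h1, rfl⟩, h2⟩, h3, h4, h5⟩
      obtain rfl := N.enc_injective h3
      obtain rfl := N.actNum_injective h4
      obtain rfl := N.enc_injective h5
      exact ⟨b, rfl, h1, h2⟩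
    · rintro ⟨b, rfl, h1, h2⟩
      exact ⟨b, N.mem_bases b, a, _, ⟨⟨s', h1, rfl⟩, h2⟩, rfl, rfl, rfl⟩
  have hone : (∃ w, ((N.enc s, N.actNum a, N.enc s'), w) ∈ N.trans j ∧ w ≠ 0) ↔
      ((N.enc s, N.actNum a, N.enc s'), 1) ∈ N.trans j := by
    refine ⟨?_, fun h => ⟨1, h, one_ne_zero⟩⟩
    rintro ⟨w, h, -⟩
    suffices w = 1 from this ▸ h
    simp only [trans, baseTrans, List.mem_append, List.mem_flatMap, List.mem_map, List.mem_cons,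
      List.not_mem_nil, or_false, Prod.mk.injEq] at h
    aesop
  have hact : N.actNum a ∈ N.acts := N.mem_acts.2 ⟨a, rfl⟩
  rw [hone, trans, List.mem_append, List.mem_append, List.mem_append, hbase]
  simp only [List.mem_flatMap, List.mem_map, List.mem_cons, List.not_mem_nil, or_false,
    Prod.mk.injEq, and_true, List.mem_range]
  rcases s with s | _ | k
  · have hlt : N.enc (.base s) < N.numBase := N.enc_lt_iff.2 ⟨s, rfl⟩
    refine Iff.trans ?_ N.mem_next_base.symm
    constructor
    · rintro (((h | ⟨a', -, h1, -, h2⟩) | ⟨a', -, h | h⟩) | ⟨k, -, a', -, h | h⟩)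
      · obtain ⟨b, -, h⟩ := h
        exact .inl h
      · have h3 := N.enc_injective h1
        exact .inr ⟨by cases h3; rfl, N.enc_injective h2.symm⟩
      all_goals omega
    · rintro (h | ⟨rfl, rfl⟩)
      · exact .inl (.inl (.inl ⟨s, rfl, h⟩))
      · exact .inl (.inl (.inr ⟨_, hact, rfl, rfl, rfl⟩))
  · have hlt := (N.base .start).2
    constructor
    · rintro (((⟨b, h, -⟩ | ⟨a', -, h1, -, h2⟩) | ⟨a', -, h | h⟩) | ⟨k, -, a', -, h | h⟩)
      · cases h
      · simp only [enc] at h1; omega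
      · have : s' = .chain 0 := N.enc_injective (a₂ := .chain 0) h.2.2
        simp [this, next, succ]
      · have := N.enc_injective h.2.2.symm
        simp [this, next, succ]
      all_goals (simp only [enc] at h; omega)
    · intro h
      simp only [next, succ, List.mem_cons, List.not_mem_nil, or_false] at h
      refine .inl (.inr ⟨_, hact, ?_⟩)
      rcases h with rfl | rfl
      · exact .inl ⟨rfl, rfl, rfl⟩
      · exact .inr ⟨rfl, rfl, rfl⟩
  · have hlt := (N.base .start).2
    constructor
    · rintro (((⟨b, h, -⟩ | ⟨a', -, h1, -, h2⟩) | ⟨a', -, h | h⟩) | ⟨m, -, a', -, h | h⟩)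
      · cases h
      · simp only [enc] at h1; omega
      · simp only [enc] at h; omega
      · simp only [enc] at h; omega
      all_goals
        have hm : m = k := by simp only [enc] at h; omega
        subst hm
      · have : s' = .chain m := N.enc_injective (a₂ := .chain m) h.2.2
        simp [this, next, succ]
      · have := N.enc_injective h.2.2.symm
        simp [this, next, succ]
    · intro h
      simp only [next, succ, List.mem_cons, List.not_mem_nil, or_false] at h
      refine .inr ⟨k, by simp only [enc] at hs; omega, _, hact, ?_⟩
      rcases h with rfl | rfl
      · exact .inl ⟨rfl, rfl, rfl⟩
      · exact .inr ⟨rfl, rfl, rfl⟩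

theorem signal_base_chain (s : Base Q Γ) (k : ℕ) :
    signal (.base s) (.chain k) = signal (.base s) (.chain 0) := by
  cases s <;> rfl

theorem mem_obs {j : ℕ} {s s' : State Q Γ} {a : Fin n → Fin N.numSym} {o : Fin n → ℕ}
    (hs : N.enc s < N.numBase + (j + 1)) (hs' : N.enc s' < N.numBase + (j + 1)) :
    (∃ w, ((N.enc s, N.actNum a, N.enc s', o), w) ∈ N.obs j ∧ w ≠ 0) ↔
      o = N.obsOf (signal s s') := by
  have hact : N.actNum a ∈ N.acts := N.mem_acts.2 ⟨a, rfl⟩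
  simp only [obs, baseObs, entryObs, List.mem_append, List.mem_flatMap, List.mem_map,
    Prod.mk.injEq, List.mem_range]
  constructor
  · rintro ⟨w, ((⟨b, -, b', -, a', -, ⟨h1, -, h2, h3⟩, -⟩ |
      ⟨k, -, t, ⟨b, -, a', -, rfl⟩, ⟨h1, -, h2, h3⟩, -⟩) |
      ⟨k, -, y, -, a', -, ⟨h1, -, h2, h3⟩, -⟩), -⟩
    · obtain rfl := N.enc_injective h1
      obtain rfl := N.enc_injective h2
      exact h3.symm
    · obtain rfl : State.base b = s := N.enc_injective h1
      obtain rfl : State.chain k = s' := N.enc_injective h2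
      rw [signal_base_chain]
      exact h3.symm
    · obtain rfl : State.chain k = s := N.enc_injective h1
      exact h3.symm
  · rintro rfl
    refine ⟨1, ?_, one_ne_zero⟩
    rcases s with b | k
    · refine .inl ?_
      rcases s' with b' | k
      · exact .inl ⟨b, N.mem_bases b, b', N.mem_bases b', _, hact, ⟨rfl, rfl, rfl, rfl⟩, rfl⟩
      · exact .inr ⟨k, by simp only [enc] at hs'; omega, _,
          ⟨b, N.mem_bases b, _, hact, rfl⟩, ⟨rfl, rfl, rfl, congrArg N.obsOf (signal_base_chain b k).symm⟩, rfl⟩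
    · exact .inr ⟨k, by simp only [enc] at hs; omega, _, hs', _, hact, ⟨rfl, rfl, rfl, rfl⟩, rfl⟩

theorem enc_lt_of_mem_next {j : ℕ} {s s' : State Q Γ} {a : Fin n → Fin N.numSym}
    (hs : N.enc s < N.numBase + (j + 1)) (h : s' ∈ N.next j s a) :
    N.enc s' < N.numBase + (j + 1) := by
  rcases s with s | _ | k
  · rcases N.mem_next_base.1 h with ⟨-, h⟩ | ⟨-, rfl⟩
    · omega
    · simp only [enc]; omega
  all_goals
    simp only [next, succ, List.mem_cons, List.not_mem_nil, or_false] at h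
    rcases h with rfl | rfl <;> simp only [enc] at hs ⊢ <;> omega

section Semantics

variable (j : ℕ)

theorem transWeight_ne_zero_iff {x x' : (N.code j).State} {a : ∀ i, (N.code j).Act i} :
    (N.code j).transWeight x a x' ≠ 0 ↔ N.dec x' ∈ N.next j (N.dec x) a := by
  have h := N.mem_trans (j := j) (s := N.dec x) (s' := N.dec x') (a := a) (by
    rw [enc_dec]; exact x.2)
  rw [enc_dec, enc_dec] at h
  exact DecPOMDPCode.weight_ne_zero_iff.trans h

theorem obsWeight_ne_zero_iff {x x' : (N.code j).State} {a : ∀ i, (N.code j).Act i}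
    {o : ∀ i, (N.code j).Obs i} : (N.code j).obsWeight x a x' o ≠ 0 ↔
      ∀ i, (o i : ℕ) = N.obsOf (signal (N.dec x) (N.dec x')) i := by
  have h := N.mem_obs (j := j) (s := N.dec x) (s' := N.dec x') (a := a) (o := fun i => o i)
    (by rw [enc_dec]; exact x.2) (by rw [enc_dec]; exact x'.2)
  rw [enc_dec, enc_dec, funext_iff] at h
  exact DecPOMDPCode.weight_ne_zero_iff.trans h

theorem obsOf_lt (p : Signal × Signal) (i : Fin n) : N.obsOf p i < 3 := by
  unfold obsOf
  split_ifs <;> exact Fin.isLt _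

theorem valid_code : (N.code j).Valid where
  init_lt := by
    have := (N.base .start).2
    change (N.base .start : ℕ) < N.numBase + (j + 1)
    omega
  acts_pos _ := (Nat.zero_le _).trans_lt (N.sym N.blank).2
  trans_pos x a := by
    have hne : ∃ s', s' ∈ N.next j (N.dec x) a := by
      by_cases h : N.dec x = .base .acc
      · exact ⟨_, by rw [h]; exact List.mem_singleton_self _⟩
      by_cases h' : N.dec x = .base .rej
      · exact ⟨_, by rw [h']; exact List.mem_singleton_self _⟩
      obtain ⟨s', hs', -⟩ := exists_rank_lt (δ := N.δ) (q₀ := N.q₀) (a := N.fst) (b := N.rest)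
        (blank := N.blank) (n := j) (N.dec x) (N.sym.symm (a N.player₀))
        (N.sym.symm (a N.player₁)) h h'
      exact ⟨s', hs'⟩
    obtain ⟨s', hs'⟩ := hne
    have hlt := N.enc_lt_of_mem_next (by rw [enc_dec]; exact x.2) hs'
    refine Finset.sum_pos' (fun _ _ => Nat.zero_le _) ⟨⟨N.enc s', hlt⟩, Finset.mem_univ _, ?_⟩
    refine Nat.pos_of_ne_zero ((N.transWeight_ne_zero_iff j).2 ?_)
    rwa [dec_enc]
  obs_pos x a x' := by
    refine Finset.sum_pos' (fun _ _ => Nat.zero_le _)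
      ⟨fun i => ⟨_, N.obsOf_lt (signal (N.dec x) (N.dec x')) i⟩, Finset.mem_univ _, ?_⟩
    exact Nat.pos_of_ne_zero ((N.obsWeight_ne_zero_iff j).2 fun i => rfl)

/-- The process described by the code of the game for the input `j`. -/
noncomputable abbrev process :
    DecPOMDP n (N.code j).State (N.code j).Act (N.code j).Obs :=
  (N.code j).toDecPOMDP (N.valid_code j)

theorem trans_ne_zero_iff {x x' : (N.code j).State} {a : ∀ i, (N.code j).Act i} :
    (N.process j).trans x a x' ≠ 0 ↔ N.dec x' ∈ N.next j (N.dec x) a :=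
  (weightPMF_ne_zero_iff (hw := (N.valid_code j).trans_pos x a)).trans
    (N.transWeight_ne_zero_iff j)

theorem obs_ne_zero_iff {x x' : (N.code j).State} {a : ∀ i, (N.code j).Act i}
    {o : ∀ i, (N.code j).Obs i} : (N.process j).obs x a x' o ≠ 0 ↔
      ∀ i, (o i : ℕ) = N.obsOf (signal (N.dec x) (N.dec x')) i :=
  (weightPMF_ne_zero_iff (hw := (N.valid_code j).obs_pos x a x')).trans
    (N.obsWeight_ne_zero_iff j)

theorem player₁_ne : N.player₁ ≠ N.player₀ := by
  simp [player₀, player₁]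

/-- Plays of the process project to plays of the two-player game. -/
theorem reach_of_reachable {F : List Signal → Γ} {x : (N.code j).State}
    {H : ∀ i, List ((N.code j).Obs i)}
    (h : (N.process j).Reachable (fun _ w => N.sym (F w)) x H) :
    Reach N.δ N.q₀ N.fst N.rest N.blank j F F (N.dec x) (H N.player₀) (H N.player₁) := by
  induction h with
  | init =>
    have : N.dec ((N.process j).init : ℕ) = .base .start :=
      N.dec_enc (.base .start)
    rw [this]
    exact .start
  | @step x H x' o _ ht ho ih =>
    have h1 := (N.trans_ne_zero_iff j).1 ht
    simp only [next, Equiv.symm_apply_apply] at h1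
    have h2 := (N.obs_ne_zero_iff j).1 ho
    have h3 := ih.step h1
    have e0 : o N.player₀ = (signal (N.dec x) (N.dec x')).1 :=
      Fin.ext ((h2 _).trans (by simp [obsOf]))
    have e1 : o N.player₁ = (signal (N.dec x) (N.dec x')).2 :=
      Fin.ext ((h2 _).trans (by simp [obsOf, N.player₁_ne]))
    rw [← e0, ← e1] at h3
    exact h3

/-- Every play of the two-player game is played in the process. -/
theorem exists_reachable_of_reach {F : ∀ i, List ((N.code j).Obs i) → (N.code j).Act i}
    {s : State Q Γ} {w v : List Signal}
    (h : Reach N.δ N.q₀ N.fst N.rest N.blank j (fun w => N.sym.symm (F N.player₀ w))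
      (fun w => N.sym.symm (F N.player₁ w)) s w v) :
    ∃ x H, (N.process j).Reachable F x H ∧ N.dec x = s ∧ H N.player₀ = w ∧ H N.player₁ = v := by
  induction h with
  | start => exact ⟨_, _, .init, N.dec_enc (.base .start), rfl, rfl⟩
  | @step s w v s' _ hs' ih =>
    obtain ⟨x, H, hr, rfl, rfl, rfl⟩ := ih
    have hs'' : s' ∈ N.next j (N.dec x) fun i => F i (H i) := hs'
    have hlt := N.enc_lt_of_mem_next (by rw [enc_dec]; exact x.2) hs''
    let x' : (N.code j).State := ⟨N.enc s', hlt⟩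
    have hx' : N.dec x' = s' := N.dec_enc s'
    refine ⟨x', _, hr.step (o := fun i => ⟨_, N.obsOf_lt (signal (N.dec x) s') i⟩)
      ((N.trans_ne_zero_iff j).2 (by rwa [hx'])) ((N.obs_ne_zero_iff j).2 fun i => by rw [hx']),
      hx', ?_, ?_⟩
    · exact congrArg (H N.player₀ ++ [·]) (Fin.ext (by simp [obsOf]))
    · exact congrArg (H N.player₁ ++ [·]) (Fin.ext (by simp [obsOf, N.player₁_ne]))

/-- The target of the game can be reached almost surely if and only if the machine runs forever. -/
theorem exists_reach_eq_one_iff :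
    (∃ σ, (N.process j).playMeasure σ
      (DecPOMDP.reach (N.code j).Act (N.code j).Obs (N.code j).targetSet) = 1) ↔
      ∃ st tp, IsRun N.δ N.q₀ (unaryTape N.fst N.rest N.blank j) st tp := by
  have hT : ∀ x : (N.code j).State, x ∈ (N.code j).targetSet ↔ N.dec x = .base .acc := by
    intro x
    change (x : ℕ) ∈ [N.enc (.base .acc)] ↔ _
    rw [List.mem_singleton]
    exact ⟨fun h => by rw [h, dec_enc], fun h => by rw [← h, enc_dec]⟩
  rw [(N.process j).exists_playMeasure_reach_eq_one_iff (N.code j).targetSet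
    {x | N.dec x = .base .rej} fun x => rank (N.dec x)]
  · constructor
    · rintro ⟨F, hF⟩
      refine exists_isRun (F := fun w => N.sym.symm (F N.player₀ w))
        (G := fun w => N.sym.symm (F N.player₁ w)) fun s w v h hs => ?_
      obtain ⟨x, H, hr, hx, -⟩ := N.exists_reachable_of_reach j h
      exact hF x H hr (hx.trans hs)
    · rintro ⟨st, tp, h⟩
      obtain ⟨F, hF⟩ := exists_passing st tp h
      exact ⟨fun _ w => N.sym (F w), fun x H hr hx => hF _ _ _ (N.reach_of_reachable j hr) hx⟩
  · intro x hx hx'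
    have := ((hT x).1 hx).symm.trans hx'
    cases this
  · intro x hx a x' h
    rw [hT] at hx ⊢
    rw [trans_ne_zero_iff, hx] at h
    exact List.mem_singleton.1 h
  · intro x hx a x' h
    rw [trans_ne_zero_iff, show N.dec x = _ from hx] at h
    exact List.mem_singleton.1 h
  · intro x a x' h
    exact rank_le_of_mem_succ ((N.trans_ne_zero_iff j).1 h)
  · intro x hx hx' a
    rw [hT] at hx
    obtain ⟨s', hs', hlt⟩ := exists_rank_lt (δ := N.δ) (q₀ := N.q₀) (a := N.fst) (b := N.rest)
      (blank := N.blank) (n := j) (N.dec x) (N.sym.symm (a N.player₀))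
      (N.sym.symm (a N.player₁)) hx hx'
    have hs'' : s' ∈ N.next j (N.dec x) a := hs'
    refine ⟨⟨N.enc s', N.enc_lt_of_mem_next (by rw [enc_dec]; exact x.2) hs''⟩, ?_, ?_⟩
    · rw [trans_ne_zero_iff]
      simpa using hs''
    · simpa using hlt

end Semantics

end Numbering

end TapeGame

/-! ### Undecidability -/

theorem mainTheorem2 (n : ℕ) (hn : 2 ≤ n) :
    ¬ ∃ f : DecPOMDPCode n → Bool, Computable f ∧
      ∀ (c : DecPOMDPCode n) (hc : c.Valid),
        f c = true ↔
          ∃ σ : DecPOMDP.StrategyProfile c.Act c.Obs,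
            (c.toDecPOMDP hc).playMeasure σ (DecPOMDP.reach c.Act c.Obs c.targetSet) = 1 := by
  rintro ⟨f, hf, hfc⟩
  obtain ⟨Q, Γ, hQ, hΓ, δ, q₀, a, b, blank, hno⟩ := TapeRun.exists_undecidable_machine
  obtain ⟨numBase, ⟨base⟩⟩ := Finite.exists_equiv_fin (TapeGame.Base Q Γ)
  obtain ⟨numSym, ⟨sym⟩⟩ := Finite.exists_equiv_fin Γ
  let N : TapeGame.Numbering n Q Γ := ⟨hn, numBase, base, numSym, sym, δ, q₀, a, b, blank⟩
  exact hno ⟨fun j => f (N.code j), hf.comp N.computable_code, fun j =>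
    (hfc _ (N.valid_code j)).trans (N.exists_reach_eq_one_iff j)⟩
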